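/- Let $\mathbb{R}^{n+1}_+=\{(x,t)\in\mathbb{R}^n\times\mathbb{R}: t>0\}$, $n\ge 1$. For an integer $m\ge1$ write $D^m u=\nabla\Delta^{\frac{m-1}{2}}u$ if $m$ is odd and $D^m u=\Delta^{\frac m2}u$ if $m$ is even, and for real $p,\alpha,\beta$ put $$p_m^*=p_m^*(\alpha,\beta):=\frac{p(n+1+\beta)}{n+1+\alpha-mp}.$$ Let $\mathcal T_m$ be the set of real functions in $C_0^\infty(\overline{\mathbb{R}^{n+1}_+})$ satisfying the boundary conditions $$\lim_{t\to0^+}\frac{\partial \Delta^{j}\varphi(x,t)}{\partial t}=0\quad\text{for all }x\in\mathbb{R}^n\text{ and all integers }0\le j<\lfloor m/2\rfloor,$$ that is, $j=0,\dots,\frac{m-1}2-1$ if $m$ is odd (no condition if $m=1$) and $j=0,\dots,\frac m2-1$ if $m$ is even; $\mathcal T_m$ contains $C_0^\infty(\mathbb{R}^{n+1}_+)$. Let $W^{m,p}_\alpha(\mathbb{R}^{n+1}_+)$ be the completion of $\mathcal T_m$ with respect to $\int_{\mathbb{R}^{n+1}_+}t^{\alpha}|D^m\varphi|^p\,dx\,dt$,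 realized as the space of those $u\in L^1_{loc}(\mathbb{R}^{n+1}_+)$ whose weak derivative $D^mu$ exists with $\int_{\mathbb{R}^{n+1}_+} t^\alpha|D^mu|^p\,dx\,dt<\infty$ and for which there are $\varphi_i\in\mathcal T_m$ with $\varphi_i\to u$ in $L^1_{loc}(\mathbb{R}^{n+1}_+)$ and $\int_{\mathbb{R}^{n+1}_+}t^{\alpha}|D^m\varphi_i-D^mu|^p\,dx\,dt\to0$. **Theorem 1.10.** (First order.) Let $n\ge1$, $1<p<n+1$, $p<p^*=p^*(\alpha_1,\beta_1):=\frac{p(n+1+\beta_1)}{n+1+\alpha_1-p}$, and $$\frac{pn}{p^*}-(n+1-p)<\alpha_1<p-1,\qquad -1<\beta_1\le\frac{\alpha_1(n+1)}{n+1-p}.$$ Then there exists a constant $S=S(n+1,p,\alpha_1,\beta_1)>0$ such that $$\Big(\int_{\mathbb{R}^{n+1}_+}t^{\beta_1}|u|^{p^*}dx\,dt\Big)^{\frac p{p^*}}\le S\int_{\mathbb{R}^{n+1}_+}t^{\alpha_1}|\nabla u|^p\,dx\,dt\qquad\text{for all }u\in W^{1,p}_{\alpha_1}(\mathbb{R}^{n+1}_+).$$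 (Higher order.) Let $n\ge1$, let $m$ be a positive integer with $mp<n$, and let $1<p<p_m^*=p_m^*(\alpha_m,\beta_m)$, $$\frac{pn}{p_m^*}-(n+1-mp)<\alpha_m<p-1,\qquad -1<\beta_m\le\frac{\alpha_m(n+1)}{n+1-mp}.$$ Then there exists a constant $C=C(n+1,p,\alpha_m,\beta_m,m)>0$ such that for all $u\in W^{m,p}_{\alpha_m}(\mathbb{R}^{n+1}_+)$: (i) if $m$ is odd, $$\Big(\int_{\mathbb{R}^{n+1}_+}t^{\beta_m}|u|^{p_m^*}dx\,dt\Big)^{\frac p{p_m^*}}\le C\int_{\mathbb{R}^{n+1}_+}t^{\alpha_m}\big|\nabla\Delta^{\frac{m-1}2}u\big|^p\,dx\,dt;$$ (ii) if $m$ is even, $$\Big(\int_{\mathbb{R}^{n+1}_+}t^{\beta_m}|u|^{p_m^*}dx\,dt\Big)^{\frac p{p_m^*}}\le C\int_{\mathbb{R}^{n+1}_+}t^{\alpha_m}\big|\Delta^{\frac m2}u\big|^p\,dx\,dt.$$ -/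

import Mathlib

open MeasureTheory Filter Topology Laplacian Gradient
open scoped ContDiff ENNReal

noncomputable section

/-- Euclidean space `ℝ^(n+1) = ℝⁿ × ℝ`; the last coordinate is the variable `t`. -/
abbrev HalfAmbient (n : ℕ) : Type := EuclideanSpace ℝ (Fin (n + 1))

/-- The last coordinate `t` of a point `(x, t)`. -/
def height {n : ℕ} (X : HalfAmbient n) : ℝ := X (Fin.last n)

/-- The unit vector in the direction of `t`. -/
def eLast (n : ℕ) : HalfAmbient n := EuclideanSpace.single (Fin.last n) 1

/-- The open upper half space `{(x, t) : t > 0}`. -/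
def halfSpace (n : ℕ) : Set (HalfAmbient n) := {X | 0 < height X}

/-- The weighted integral `∫_{t > 0} t ^ a * ‖F‖ ^ q`, with values in `[0, ∞]`. -/
def wInt {n : ℕ} {V : Type*} [NormedAddCommGroup V] (a q : ℝ) (F : HalfAmbient n → V) : ℝ≥0∞ :=
  ∫⁻ X in halfSpace n, ENNReal.ofReal (height X ^ a) * ‖F X‖ₑ ^ q

/-- The iterated Laplacian `Δ^k`. -/
def lapPow {n : ℕ} (k : ℕ) (f : HalfAmbient n → ℝ) : HalfAmbient n → ℝ :=
  (fun g : HalfAmbient n → ℝ => Δ g)^[k] f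

/-- The boundary conditions `lim_{t → 0+} ∂_t Δ^j f (x, t) = 0` for all `x ∈ ℝⁿ` and `j < r`. -/
def NeumannCond {n : ℕ} (r : ℕ) (f : HalfAmbient n → ℝ) : Prop :=
  ∀ j < r, ∀ X : HalfAmbient n, height X = 0 →
    Tendsto (fun t : ℝ => fderiv ℝ (lapPow j f) (X + t • eLast n) (eLast n)) (𝓝[>] 0) (𝓝 0)

/-- The test functions: smooth functions with compact support in the closed half space (each is
represented by a smooth compactly supported extension to `ℝ^(n+1)`), subject to the first `r`
boundary conditions. There are none for `r = 0`. All smooth functions with compact support in the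
open half space belong to this class, see `isTest_of_tsupport_subset`. -/
structure IsTest {n : ℕ} (r : ℕ) (φ : HalfAmbient n → ℝ) : Prop where
  smooth : ContDiff ℝ ∞ φ
  compact : HasCompactSupport φ
  neumann : NeumannCond r φ

theorem lapPow_eventuallyEq_zero {n : ℕ} (k : ℕ) {f : HalfAmbient n → ℝ} {X : HalfAmbient n}
    (h : f =ᶠ[𝓝 X] 0) : lapPow k f =ᶠ[𝓝 X] 0 := by
  induction k with
  | zero => simpa [lapPow] using h
  | succ k ih =>
    have h1 := InnerProductSpace.laplacian_congr_nhds ih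
    have h2 : (Δ (0 : HalfAmbient n → ℝ)) = 0 := by
      have := InnerProductSpace.laplacian_const (E := HalfAmbient n) (c := (0 : ℝ))
      exact this
    rw [h2] at h1
    unfold lapPow
    rw [Function.iterate_succ_apply']
    exact h1

theorem isTest_of_tsupport_subset {n : ℕ} (r : ℕ) {φ : HalfAmbient n → ℝ} (h1 : ContDiff ℝ ∞ φ)
    (h2 : HasCompactSupport φ) (h3 : tsupport φ ⊆ halfSpace n) : IsTest r φ := by
  refine ⟨h1, h2, fun j _ X hX => ?_⟩
  have hmem : X ∉ tsupport φ := fun h => by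
    have h4 : 0 < height X := h3 h
    rw [hX] at h4
    exact lt_irrefl _ h4
  have h0 : lapPow j φ =ᶠ[𝓝 X] 0 :=
    lapPow_eventuallyEq_zero j (notMem_tsupport_iff_eventuallyEq.mp hmem)
  have hd := h0.fderiv (𝕜 := ℝ)
  have hc : Tendsto (fun t : ℝ => X + t • eLast n) (𝓝[>] 0) (𝓝 X) := by
    have : Continuous (fun t : ℝ => X + t • eLast n) := by fun_prop
    have h := this.tendsto 0
    simp only [zero_smul, add_zero] at h
    exact h.mono_left nhdsWithin_le_nhds
  have he := hc.eventually hd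
  refine tendsto_const_nhds.congr' ?_
  filter_upwards [he] with t ht
  rw [ht]
  simp

/-- `g` is the weak `Δ^k` of `u` in the open half space. -/
structure IsWeakLap {n : ℕ} (k : ℕ) (u g : HalfAmbient n → ℝ) : Prop where
  locInt : LocallyIntegrableOn g (halfSpace n)
  eq : ∀ ψ : HalfAmbient n → ℝ, ContDiff ℝ ∞ ψ → HasCompactSupport ψ → tsupport ψ ⊆ halfSpace n →
    ∫ X in halfSpace n, ψ X * g X = ∫ X in halfSpace n, u X * lapPow k ψ X

/-- `G` is the weak `∇ Δ^k` of `u` in the open half space; for `k = 0` it is the weak gradient. -/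
structure IsWeakGradLap {n : ℕ} (k : ℕ) (u : HalfAmbient n → ℝ) (G : HalfAmbient n → HalfAmbient n) :
    Prop where
  locInt : LocallyIntegrableOn G (halfSpace n)
  eq : ∀ ψ : HalfAmbient n → ℝ, ContDiff ℝ ∞ ψ → HasCompactSupport ψ → tsupport ψ ⊆ halfSpace n →
    ∫ X in halfSpace n, ψ X • G X = -∫ X in halfSpace n, u X • ∇ (lapPow k ψ) X

/-- Convergence `φ i → u` in `L¹_loc` of the open half space. -/
def TendstoL1Loc {n : ℕ} (φ : ℕ → HalfAmbient n → ℝ) (u : HalfAmbient n → ℝ) : Prop :=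
  ∀ K : Set (HalfAmbient n), IsCompact K → K ⊆ halfSpace n →
    Tendsto (fun i => ∫⁻ X in K, ‖φ i X - u X‖ₑ) atTop (𝓝 0)

/-- The space `W_a^{m,p}` with `m = 2k+1`, as a space of functions on the open half space: the
completion of the test functions, with the boundary conditions `∂_t Δ^j = 0`, `j < k`, for the norm
given by `∫ t ^ a * |∇ Δ^k φ| ^ p`. -/
def MemSobolevOdd {n : ℕ} (k : ℕ) (a p : ℝ) (u : HalfAmbient n → ℝ) : Prop :=
  LocallyIntegrableOn u (halfSpace n) ∧
  ∃ G : HalfAmbient n → HalfAmbient n, IsWeakGradLap k u G ∧ wInt a p G < ⊤ ∧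
    ∃ φ : ℕ → HalfAmbient n → ℝ, (∀ i, IsTest k (φ i)) ∧ TendstoL1Loc φ u ∧
      Tendsto (fun i => wInt a p (fun X => ∇ (lapPow k (φ i)) X - G X)) atTop (𝓝 0)

/-- The space `W_a^{m,p}` with `m = 2k`, as a space of functions on the open half space: the
completion of the test functions, with the boundary conditions `∂_t Δ^j = 0`, `j < k`, for the norm
given by `∫ t ^ a * |Δ^k φ| ^ p`. -/
def MemSobolevEven {n : ℕ} (k : ℕ) (a p : ℝ) (u : HalfAmbient n → ℝ) : Prop :=
  LocallyIntegrableOn u (halfSpace n) ∧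
  ∃ g : HalfAmbient n → ℝ, IsWeakLap k u g ∧ wInt a p g < ⊤ ∧
    ∃ φ : ℕ → HalfAmbient n → ℝ, (∀ i, IsTest k (φ i)) ∧ TendstoL1Loc φ u ∧
      Tendsto (fun i => wInt a p (fun X => lapPow k (φ i) X - g X)) atTop (𝓝 0)

/-- The exponent `p (n + 1 + b) / (n + 1 + a - m p)`. -/
def critExp (n m : ℕ) (p a b : ℝ) : ℝ := p * (n + 1 + b) / (n + 1 + a - m * p)

/-- The conditions on the exponents for the inequality of order `m`. -/
structure ExpCond (n m : ℕ) (p a b : ℝ) : Prop where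
  one_lt : 1 < p
  lt_critExp : p < critExp n m p a b
  lower : p * n / critExp n m p a b - (n + 1 - m * p) < a
  upper : a < p - 1
  neg_one_lt : -1 < b
  le : b ≤ a * (n + 1) / (n + 1 - m * p)

end

/-! Write `N = n + 1`, and let `q` be the critical exponent. Put `x = 1/p`, `y = 1/q`, `a = α/p`, `b
= β/q`. The hypotheses then turn into `RieszCond`: `0 < y < x < 1`, `b ≤ a`, `-y < b`, `a < 1 - x`,
and the scaling identity `N x + a - m = N y + b`.

The analytic core is a Stein–Weiss type bound on the half space (`exists_weightedKernel_bound`): the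
kernel `t^b s^(-a) |X - Y|^(-(N - r))` maps `L^(1/x)` to `L^(1/y)`. Where `|X - Y| < t/2` the two
heights are comparable, and `b ≤ a` lets the weights be absorbed into the power of `|X - Y|`, so
that the Hardy–Littlewood–Sobolev inequality applies. In the remaining region a Schur test works,
with majorants built from the distance to the boundary projection of one of the two points.

Test functions enter through two pointwise bounds by Riesz potentials over the half space alone. For
order one, integrating the gradient along rays that point upwards gives `|φ| ≤ c I₁|∇φ|` with no
boundary condition (`exists_enorm_le_riesz_one`). For order two, the vanishing normal derivative
makes the even reflection regular enough for Green's identity against a regularized fundamental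
solution, whence `|φ| ≤ c I₂|Δφ|` (`exists_enorm_le_riesz_two`).

The boundary conditions say that each `Δ^j φ` concerned is again admissible for the second bound.
The higher order inequality is therefore a chain of second order ones, preceded by one first order
step if `m` is odd. The exponents and weights in between lie on the segment from `(x, a)` to `(y,
b)`, and `RieszCond` survives this interpolation. Fatou's lemma and uniqueness of weak derivatives
extend the result to the completion. -/

theorem ENNReal.ofReal_rpow_mul_rpow {a x y : ℝ} (ha : 0 < a) :
    ENNReal.ofReal (a ^ x) * ENNReal.ofReal (a ^ y) = ENNReal.ofReal (a ^ (x + y)) := by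
  rw [← ENNReal.ofReal_mul (by positivity), Real.rpow_add ha]

/-! ### The Hardy–Littlewood–Sobolev inequality. -/

section Riesz

variable {E : Type*} [NormedAddCommGroup E] [NormedSpace ℝ E] [FiniteDimensional ℝ E]
  [MeasurableSpace E] [BorelSpace E] (μ : Measure E) [μ.IsAddHaarMeasure]

/-- Change of variables `Z = R • W` in a Lebesgue integral. -/
theorem lintegral_eq_lintegral_comp_smul {R : ℝ} (hR : 0 < R) (F : E → ℝ≥0∞) :
    ∫⁻ Z, F Z ∂μ = ENNReal.ofReal (R ^ (Module.finrank ℝ E : ℝ)) * ∫⁻ W, F (R • W) ∂μ := by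
  have e : MeasurableEmbedding (fun W : E => R • W) :=
    (Homeomorph.smulOfNeZero R hR.ne').measurableEmbedding
  have h := e.lintegral_map (μ := μ) F
  rw [Measure.map_addHaar_smul μ hR.ne', lintegral_smul_measure] at h
  rw [← h, smul_eq_mul, ← mul_assoc, ← ENNReal.ofReal_mul (by positivity), Real.rpow_natCast,
    abs_of_pos (by positivity), mul_inv_cancel₀ (by positivity)]
  simp

theorem lintegral_indicator_norm_rpow_scale {R l : ℝ} (hR : 0 < R) (s : Set ℝ) :
    ∫⁻ Z, (norm ⁻¹' s : Set E).indicator (fun Z => ENNReal.ofReal (‖Z‖ ^ (-l))) Z ∂μ =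
      ENNReal.ofReal (R ^ ((Module.finrank ℝ E : ℝ) - l)) *
      ∫⁻ Z, (norm ⁻¹' ((R * ·) ⁻¹' s) : Set E).indicator
        (fun Z => ENNReal.ofReal (‖Z‖ ^ (-l))) Z ∂μ := by
  rw [lintegral_eq_lintegral_comp_smul μ hR, sub_eq_add_neg, ← ENNReal.ofReal_rpow_mul_rpow hR,
    mul_assoc]
  congr 1
  rw [← lintegral_const_mul' _ _ ENNReal.ofReal_ne_top]
  refine lintegral_congr fun W => ?_
  classical
  simp only [Set.indicator_apply, Set.mem_preimage, norm_smul, Real.norm_of_nonneg hR.le]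
  split_ifs
  · rw [← ENNReal.ofReal_mul (by positivity), Real.mul_rpow hR.le (norm_nonneg _)]
  · simp

theorem lintegral_norm_rpow_near_ne_top (hE : 1 ≤ Module.finrank ℝ E) {l : ℝ}
    (hl : l < Module.finrank ℝ E) :
    ∫⁻ Z, (norm ⁻¹' (Set.Iio 1) : Set E).indicator
        (fun Z => ENNReal.ofReal (‖Z‖ ^ (-l))) Z ∂μ ≠ ⊤ := by
  have h := integrableOn_ball_of_norm_le_rpow (μ := μ) hE (f := fun Z : E => ‖Z‖ ^ (-l)) (C := 1)
    (r := 1) hl (Eventually.of_forall fun x => by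
      rw [one_mul, Real.norm_of_nonneg (by positivity)])
    (Measurable.aestronglyMeasurable (by fun_prop))
  have h2 : (norm ⁻¹' (Set.Iio 1) : Set E) = Metric.ball 0 1 := by ext; simp
  rw [h2, lintegral_indicator Metric.isOpen_ball.measurableSet]
  exact h.setLIntegral_lt_top.ne

theorem lintegral_norm_rpow_far_ne_top {l : ℝ} (hl : (Module.finrank ℝ E : ℝ) < l) :
    ∫⁻ Z, (norm ⁻¹' (Set.Ici 1) : Set E).indicator
        (fun Z => ENNReal.ofReal (‖Z‖ ^ (-l))) Z ∂μ ≠ ⊤ := by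
  have h := finite_integral_one_add_norm (μ := μ) hl
  have hl0 : 0 < l := lt_of_le_of_lt (by positivity) hl
  -- Where `‖Z‖ ≥ 1` one has `1 + ‖Z‖ ≤ 2 ‖Z‖`, which costs the factor `2 ^ l`.
  refine ne_top_of_le_ne_top (b := ENNReal.ofReal (2 ^ l) *
    ∫⁻ x : E, ENNReal.ofReal ((1 + ‖x‖) ^ (-l)) ∂μ) (ENNReal.mul_ne_top (by simp) h.ne) ?_
  rw [← lintegral_const_mul' _ _ ENNReal.ofReal_ne_top]
  refine lintegral_mono fun Z => ?_
  classical
  rw [Set.indicator_apply]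
  split_ifs with hZ
  · have hZ : 1 ≤ ‖Z‖ := hZ
    rw [← ENNReal.ofReal_mul (by positivity)]
    refine ENNReal.ofReal_le_ofReal ?_
    have : ‖Z‖ = 2⁻¹ * (2 * ‖Z‖) := by ring
    conv_lhs => rw [this, Real.mul_rpow (by positivity) (by positivity),
      Real.inv_rpow (by positivity), ← Real.rpow_neg (by positivity), neg_neg]
    exact mul_le_mul_of_nonneg_left
      (Real.rpow_le_rpow_of_nonpos (by positivity) (by linarith) (by linarith)) (by positivity)
  · positivity

/-- The Riesz kernel of homogeneity `-d κ` tested against a power of a function with prescribed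
bounds in `L¹` and `L∞`. -/
theorem exists_lintegral_riesz_le (hE : 1 ≤ Module.finrank ℝ E) {κ θ : ℝ} (hκ : κ < 1)
    (hθ0 : 0 < θ) (hθ1 : θ < 1) (hκθ : 1 - θ < κ) :
    ∃ C : ℝ≥0∞, C ≠ ⊤ ∧ ∀ (X : E) (M : ℝ≥0∞) (h : E → ℝ≥0∞), Measurable h → (∀ Y, h Y ≤ M) →
      ∫⁻ Y, h Y ∂μ ≤ 1 →
      ∫⁻ Y, ENNReal.ofReal (‖X - Y‖ ^ (-((Module.finrank ℝ E : ℝ) * κ))) * h Y ^ θ ∂μ ≤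
        C * M ^ (κ - 1 + θ) := by
  set d : ℝ := (Module.finrank ℝ E : ℝ) with hd
  have hd1 : 1 ≤ d := by rw [hd]; exact_mod_cast hE
  have hd0 : 0 < d := by linarith
  set l := d * κ with hl
  have hlm : d < l / (1 - θ) := by
    rw [lt_div_iff₀ (by linarith), hl]; nlinarith
  set c1 := ∫⁻ Z, (norm ⁻¹' (Set.Iio 1) : Set E).indicator
        (fun Z => ENNReal.ofReal (‖Z‖ ^ (-l))) Z ∂μ with hc1
  set c2 := ∫⁻ Z, (norm ⁻¹' (Set.Ici 1) : Set E).indicator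
        (fun Z => ENNReal.ofReal (‖Z‖ ^ (-(l / (1 - θ))))) Z ∂μ with hc2
  have h1 : c1 ≠ ⊤ := lintegral_norm_rpow_near_ne_top μ hE (by rw [hl]; nlinarith)
  have h2 : c2 ≠ ⊤ := lintegral_norm_rpow_far_ne_top μ hlm
  -- The summand `1` keeps the constant nonzero, so that the right side is `⊤` when `M = ⊤`.
  refine ⟨c1 + c2 ^ (1 - θ) + 1, by simp [h1, h2, ENNReal.rpow_eq_top_iff, hθ1.le], ?_⟩
  intro X M h hm hM hint
  rcases eq_or_ne M 0 with rfl | hM0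
  · have : ∀ Y, h Y = 0 := fun Y => le_antisymm (hM Y) bot_le
    simp [this, hθ0]
  rcases eq_or_ne M ⊤ with rfl | hMt
  · rw [ENNReal.top_rpow_of_pos (by linarith), ENNReal.mul_top (by simp)]; exact le_top
  set m := M.toReal with hmdef
  have hm0 : 0 < m := ENNReal.toReal_pos hM0 hMt
  have hMm : M = ENNReal.ofReal m := (ENNReal.ofReal_toReal hMt).symm
  -- This radius balances the two regions. Inside it, `h ≤ M` is used; outside it, Hölder with
  -- exponents `θ` and `1 - θ` and `∫ h ≤ 1`. Both contributions scale like `M ^ (κ - 1 + θ)`.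
  set R := m ^ (-(1 / d)) with hR
  have hR0 : 0 < R := by positivity
  have hsplit : ∀ Y, ENNReal.ofReal (‖X - Y‖ ^ (-l)) * h Y ^ θ ≤
      (fun Z => (norm ⁻¹' (Set.Iio R) : Set E).indicator
        (fun Z => ENNReal.ofReal (‖Z‖ ^ (-l))) Z * M ^ θ) (X - Y) +
      (h Y) ^ θ * ((fun Z => (norm ⁻¹' (Set.Ici R) : Set E).indicator
        (fun Z => ENNReal.ofReal (‖Z‖ ^ (-(l / (1 - θ))))) Z) (X - Y)) ^ (1 - θ) := by
    intro Y
    classical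
    simp only [Set.indicator_apply, Set.mem_preimage, Set.mem_Iio, Set.mem_Ici]
    rcases lt_or_ge (‖X - Y‖) R with hlt | hge
    · simp only [hlt, if_true]
      refine le_add_right ?_
      gcongr
      exact hM Y
    · simp only [hge, not_lt.mpr hge, if_true, if_false]
      rw [ENNReal.ofReal_rpow_of_nonneg (by positivity) (by linarith), ← Real.rpow_mul (by positivity)]
      have : -(l / (1 - θ)) * (1 - θ) = -l := by
        have : 1 - θ ≠ 0 := by linarith
        field_simp
      rw [this, mul_comm]
      simp
  refine (lintegral_mono hsplit).trans ?_
  have mk1 : Measurable (fun Z : E => (norm ⁻¹' (Set.Iio R) : Set E).indicator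
        (fun Z => ENNReal.ofReal (‖Z‖ ^ (-l))) Z) :=
    Measurable.indicator (by fun_prop) (measurable_norm measurableSet_Iio)
  have mk2 : Measurable (fun Z : E => (norm ⁻¹' (Set.Ici R) : Set E).indicator
        (fun Z => ENNReal.ofReal (‖Z‖ ^ (-(l / (1 - θ))))) Z) :=
    Measurable.indicator (by fun_prop) (measurable_norm measurableSet_Ici)
  rw [lintegral_add_left (by fun_prop)]
  have near : ∫⁻ Y, (fun Z => (norm ⁻¹' (Set.Iio R) : Set E).indicator
        (fun Z => ENNReal.ofReal (‖Z‖ ^ (-l))) Z * M ^ θ) (X - Y) ∂μ ≤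
        c1 * M ^ (κ - 1 + θ) := by
    rw [lintegral_sub_left_eq_self (fun Z => (norm ⁻¹' (Set.Iio R) : Set E).indicator
        (fun Z => ENNReal.ofReal (‖Z‖ ^ (-l))) Z * M ^ θ), lintegral_mul_const _ mk1,
      lintegral_indicator_norm_rpow_scale μ hR0]
    have : ((R * ·) ⁻¹' (Set.Iio R) : Set ℝ) = Set.Iio 1 := by
      ext z; simp [hR0, div_self hR0.ne']
    rw [this, ← hc1, ← hd, hMm, ENNReal.ofReal_rpow_of_pos hm0, ENNReal.ofReal_rpow_of_pos hm0,
      mul_comm _ c1, mul_assoc, hR, ← Real.rpow_mul hm0.le, ENNReal.ofReal_rpow_mul_rpow hm0]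
    have : -(1 / d) * (d - l) + θ = κ - 1 + θ := by rw [hl]; field_simp; ring
    rw [this]
  have far : ∫⁻ Y, (h Y) ^ θ * ((fun Z => (norm ⁻¹' (Set.Ici R) : Set E).indicator
        (fun Z => ENNReal.ofReal (‖Z‖ ^ (-(l / (1 - θ))))) Z) (X - Y)) ^ (1 - θ) ∂μ ≤
        c2 ^ (1 - θ) * M ^ (κ - 1 + θ) := by
    refine (ENNReal.lintegral_mul_norm_pow_le (by fun_prop) (by fun_prop) hθ0.le (by linarith)
      (by ring)).trans ?_
    rw [lintegral_sub_left_eq_self (fun Z => (norm ⁻¹' (Set.Ici R) : Set E).indicator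
        (fun Z => ENNReal.ofReal (‖Z‖ ^ (-(l / (1 - θ))))) Z),
      lintegral_indicator_norm_rpow_scale μ hR0]
    have : ((R * ·) ⁻¹' (Set.Ici R) : Set ℝ) = Set.Ici 1 := by
      ext z; simp [hR0, div_self hR0.ne']
    rw [this, ← hc2, ← hd, hMm, ENNReal.ofReal_rpow_of_pos hm0,
      ENNReal.mul_rpow_of_nonneg _ _ (by linarith : 0 ≤ 1 - θ),
      ENNReal.ofReal_rpow_of_pos (by positivity), hR, ← Real.rpow_mul hm0.le,
      ← Real.rpow_mul hm0.le]
    have : -(1 / d) * (d - l / (1 - θ)) * (1 - θ) = κ - 1 + θ := by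
      have : 1 - θ ≠ 0 := by linarith
      rw [hl]; field_simp; ring
    rw [this, mul_comm _ (c2 ^ (1 - θ))]
    refine mul_le_of_le_one_left bot_le ?_
    exact ENNReal.rpow_le_one hint hθ0.le
  refine (add_le_add near far).trans ?_
  rw [← add_mul]
  exact mul_le_mul_left le_self_add _

/-- The **Hardy–Littlewood–Sobolev inequality** in bilinear form, for normalized functions. -/
theorem exists_hardyLittlewoodSobolev (hE : 1 ≤ Module.finrank ℝ E) {x y : ℝ} (hx : x < 1)
    (hy : 0 < y) (hxy : y < x) :
    ∃ C : ℝ≥0∞, C ≠ ⊤ ∧ ∀ φ ψ : E → ℝ≥0∞, Measurable φ → Measurable ψ →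
      ∫⁻ Y, φ Y ∂μ ≤ 1 → ∫⁻ X, ψ X ∂μ ≤ 1 →
      ∫⁻ X, ∫⁻ Y, ENNReal.ofReal (‖X - Y‖ ^ (-((Module.finrank ℝ E : ℝ) * (1 - x + y)))) *
        φ Y ^ x * ψ X ^ (1 - y) ∂μ ∂μ ≤ C := by
  obtain ⟨C1, hC1, h1⟩ := exists_lintegral_riesz_le μ hE (κ := 1 - x + y) (θ := x) (by linarith)
    (by linarith) hx (by linarith)
  obtain ⟨C2, hC2, h2⟩ := exists_lintegral_riesz_le μ hE (κ := 1 - x + y) (θ := 1 - y)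
    (by linarith) (by linarith) (by linarith) (by linarith)
  refine ⟨C1 + C2, by simp [hC1, hC2], fun φ ψ hφ hψ iφ iψ => ?_⟩
  set k : E → E → ℝ≥0∞ := fun X Y =>
    ENNReal.ofReal (‖X - Y‖ ^ (-((Module.finrank ℝ E : ℝ) * (1 - x + y)))) with hk
  have hkm : Measurable (Function.uncurry k) := by
    simp only [hk, Function.uncurry_def]; fun_prop
  -- The double integral is split according to which of `φ Y`, `ψ X` is larger. The smaller one is
  -- then bounded by the larger, which serves as `M` in the Riesz bound. The powers add up to
  -- exactly `1`, leaving `∫ ψ` or `∫ φ`.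
  set φ' : E → E → ℝ≥0∞ := fun X Y => {Y | φ Y < ψ X}.indicator φ Y with hφ'
  set ψ' : E → E → ℝ≥0∞ := fun X Y => {X | ψ X ≤ φ Y}.indicator ψ X with hψ'
  have mφ' : Measurable (Function.uncurry φ') := by
    have : Function.uncurry φ' = {z : E × E | φ z.2 < ψ z.1}.indicator (fun z => φ z.2) := by
      ext z; simp [hφ', Function.uncurry_def, Set.indicator_apply]
    rw [this]
    exact Measurable.indicator (by fun_prop) (measurableSet_lt (by fun_prop) (by fun_prop))
  have mψ' : Measurable (Function.uncurry ψ') := by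
    have : Function.uncurry ψ' = {z : E × E | ψ z.1 ≤ φ z.2}.indicator (fun z => ψ z.1) := by
      ext z; simp [hψ', Function.uncurry_def, Set.indicator_apply]
    rw [this]
    exact Measurable.indicator (by fun_prop) (measurableSet_le (by fun_prop) (by fun_prop))
  have hsplit : ∀ X Y, k X Y * φ Y ^ x * ψ X ^ (1 - y) ≤
      ψ X ^ (1 - y) * (k X Y * φ' X Y ^ x) + φ Y ^ x * (k X Y * ψ' X Y ^ (1 - y)) := by
    intro X Y
    simp only [hφ', hψ', Set.indicator_apply, Set.mem_ofPred_eq]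
    rcases lt_or_ge (φ Y) (ψ X) with h | h
    · simp only [h, if_true]
      refine le_add_right (le_of_eq (by ring))
    · simp only [h, if_true]
      refine le_add_left (le_of_eq (by ring))
  have hpos1 : 0 < 1 - x := by linarith
  have hpos2 : 0 < 1 - y := by linarith
  calc ∫⁻ X, ∫⁻ Y, k X Y * φ Y ^ x * ψ X ^ (1 - y) ∂μ ∂μ
      ≤ ∫⁻ X, ∫⁻ Y, (ψ X ^ (1 - y) * (k X Y * φ' X Y ^ x) +
          φ Y ^ x * (k X Y * ψ' X Y ^ (1 - y))) ∂μ ∂μ :=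
        lintegral_mono fun X => lintegral_mono fun Y => hsplit X Y
    _ = ∫⁻ X, ∫⁻ Y, ψ X ^ (1 - y) * (k X Y * φ' X Y ^ x) ∂μ ∂μ +
        ∫⁻ X, ∫⁻ Y, φ Y ^ x * (k X Y * ψ' X Y ^ (1 - y)) ∂μ ∂μ := by
        rw [← lintegral_add_left]
        · congr with X
          rw [lintegral_add_left]
          have := mφ'.of_uncurry_left (x := X)
          have := hkm.of_uncurry_left (x := X)
          fun_prop
        · refine Measurable.lintegral_prod_right' (f := fun z : E × E =>
            ψ z.1 ^ (1 - y) * (k z.1 z.2 * φ' z.1 z.2 ^ x)) ?_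
          exact (by fun_prop : Measurable fun z : E × E => ψ z.1 ^ (1 - y)).mul
            (hkm.mul (mφ'.pow_const x))
    _ ≤ C1 * 1 + C2 * 1 := by
        refine add_le_add ?_ ?_
        · calc ∫⁻ X, ∫⁻ Y, ψ X ^ (1 - y) * (k X Y * φ' X Y ^ x) ∂μ ∂μ
              ≤ ∫⁻ X, C1 * ψ X ∂μ := by
                refine lintegral_mono fun X => ?_
                have m1 := mφ'.of_uncurry_left (x := X)
                have m2 := hkm.of_uncurry_left (x := X)
                rw [lintegral_const_mul _ (by fun_prop)]
                refine (mul_le_mul_right (h1 X (ψ X) (φ' X) m1 (fun Y => ?_) ?_) _).trans ?_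
                · simp only [hφ', Set.indicator_apply, Set.mem_ofPred_eq]
                  split_ifs with h
                  · exact h.le
                  · exact bot_le
                · exact (lintegral_mono fun Y => Set.indicator_le_self _ _ _).trans iφ
                · rw [mul_left_comm, ← ENNReal.rpow_add_of_nonneg _ _ (by linarith) (by linarith)]
                  refine le_of_eq ?_
                  rw [show 1 - y + (1 - x + y - 1 + x) = 1 by ring, ENNReal.rpow_one]
            _ ≤ C1 * 1 := by
                rw [lintegral_const_mul _ hψ]; gcongr
        · rw [lintegral_lintegral_swap]
          swap
          · refine Measurable.aemeasurable ?_
            exact (by fun_prop : Measurable fun z : E × E => φ z.2 ^ x).mul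
              (hkm.mul (mψ'.pow_const _))
          calc ∫⁻ Y, ∫⁻ X, φ Y ^ x * (k X Y * ψ' X Y ^ (1 - y)) ∂μ ∂μ
              ≤ ∫⁻ Y, C2 * φ Y ∂μ := by
                refine lintegral_mono fun Y => ?_
                have m1 := mψ'.of_uncurry_right (y := Y)
                have m2 := hkm.of_uncurry_right (y := Y)
                rw [lintegral_const_mul _ (by fun_prop)]
                have hsymm : ∀ X, k X Y = k Y X := fun X => by simp only [hk, norm_sub_rev]
                simp_rw [hsymm]
                refine (mul_le_mul_right (h2 Y (φ Y) (fun X => ψ' X Y) m1 (fun X => ?_) ?_) _).trans ?_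
                · simp only [hψ', Set.indicator_apply, Set.mem_ofPred_eq]
                  split_ifs with h
                  · exact h
                  · exact bot_le
                · exact (lintegral_mono fun Y => Set.indicator_le_self _ _ _).trans iψ
                · rw [mul_left_comm, ← ENNReal.rpow_add_of_nonneg _ _ (by linarith) (by linarith)]
                  refine le_of_eq ?_
                  rw [show x + (1 - x + y - 1 + (1 - y)) = 1 by ring, ENNReal.rpow_one]
            _ ≤ C2 * 1 := by
                rw [lintegral_const_mul _ hφ]; gcongr
    _ = C1 + C2 := by simp

end Riesz

/-! ### Schur test and duality. -/

section Schur

variable {α β : Type*} [MeasurableSpace α] [MeasurableSpace β] {μ : Measure α} {ν : Measure β}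

/-- A Schur test for bilinear forms on `L^(1/x) × L^(1/(1-y))`, for normalized functions. -/
theorem lintegral_bilinear_le_of_schur [SFinite μ] [SFinite ν] {x y : ℝ} (hx : x ≤ 1) (hy : 0 ≤ y)
    (hxy : y ≤ x) {k A B : α → β → ℝ≥0∞} (hA : Measurable (Function.uncurry A))
    (hB : Measurable (Function.uncurry B)) (hk : ∀ X Y, k X Y ≤ A X Y ^ y * B X Y ^ (1 - x))
    {C₁ C₂ : ℝ≥0∞} (h₁ : ∀ Y, ∫⁻ X, A X Y ∂μ ≤ C₁) (h₂ : ∀ X, ∫⁻ Y, B X Y ∂ν ≤ C₂)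
    {φ : β → ℝ≥0∞} {ψ : α → ℝ≥0∞} (hφ : Measurable φ) (hψ : Measurable ψ)
    (iφ : ∫⁻ Y, φ Y ∂ν ≤ 1) (iψ : ∫⁻ X, ψ X ∂μ ≤ 1) :
    ∫⁻ X, ∫⁻ Y, k X Y * φ Y ^ x * ψ X ^ (1 - y) ∂ν ∂μ ≤ C₁ ^ y * C₂ ^ (1 - x) := by
  have hx' : 0 ≤ 1 - x := by linarith
  have hxy' : 0 ≤ x - y := by linarith
  have mA : Measurable fun z : α × β => A z.1 z.2 := hA
  have mB : Measurable fun z : α × β => B z.1 z.2 := hB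
  -- Hölder on the product space with the three exponents `y`, `1 - x`, `x - y`, whose sum is `1`.
  -- Each of the three factors has an integral controlled by the hypotheses.
  set F : Fin 3 → α × β → ℝ≥0∞ := ![fun z => A z.1 z.2 * φ z.2, fun z => B z.1 z.2 * ψ z.1,
    fun z => φ z.2 * ψ z.1] with hF
  set e : Fin 3 → ℝ := ![y, 1 - x, x - y] with he
  have hFm : ∀ i, Measurable (F i) := by
    intro i
    fin_cases i <;> simp only [hF] <;> dsimp <;> fun_prop
  have hol := ENNReal.lintegral_prod_norm_pow_le (μ := μ.prod ν) Finset.univ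
    (f := F) (fun i _ => (hFm i).aemeasurable) (p := e)
    (by simp [he, Fin.sum_univ_three]; ring) (by intro i _; fin_cases i <;> simp [he] <;> linarith)
  simp only [Fin.prod_univ_three] at hol
  have e0 : e 0 = y := rfl
  have e1 : e 1 = 1 - x := rfl
  have e2 : e 2 = x - y := rfl
  rw [e0, e1, e2] at hol
  have hpt : ∀ X Y, k X Y * φ Y ^ x * ψ X ^ (1 - y) ≤
      F 0 (X, Y) ^ y * F 1 (X, Y) ^ (1 - x) * F 2 (X, Y) ^ (x - y) := by
    intro X Y
    have f0 : F 0 (X, Y) = A X Y * φ Y := rfl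
    have f1 : F 1 (X, Y) = B X Y * ψ X := rfl
    have f2 : F 2 (X, Y) = φ Y * ψ X := rfl
    rw [f0, f1, f2, ENNReal.mul_rpow_of_nonneg _ _ hy, ENNReal.mul_rpow_of_nonneg _ _ hx',
      ENNReal.mul_rpow_of_nonneg _ _ hxy']
    have g1 : φ Y ^ x = φ Y ^ y * φ Y ^ (x - y) := by
      rw [← ENNReal.rpow_add_of_nonneg _ _ hy hxy']; congr 1; ring
    have g2 : ψ X ^ (1 - y) = ψ X ^ (1 - x) * ψ X ^ (x - y) := by
      rw [← ENNReal.rpow_add_of_nonneg _ _ hx' hxy']; congr 1; ring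
    rw [g1, g2]
    calc _ ≤ A X Y ^ y * B X Y ^ (1 - x) * (φ Y ^ y * φ Y ^ (x - y)) *
        (ψ X ^ (1 - x) * ψ X ^ (x - y)) := by gcongr; exact hk X Y
      _ = _ := by ring
  have i0 : ∫⁻ z, F 0 z ∂(μ.prod ν) ≤ C₁ := by
    change ∫⁻ z : α × β, A z.1 z.2 * φ z.2 ∂(μ.prod ν) ≤ C₁
    rw [lintegral_prod_symm' _ (by fun_prop)]
    calc _ ≤ ∫⁻ Y, C₁ * φ Y ∂ν := by
          refine lintegral_mono fun Y => ?_
          dsimp only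
          rw [lintegral_mul_const _ (hA.of_uncurry_right)]
          gcongr
          exact h₁ Y
      _ ≤ C₁ * 1 := by rw [lintegral_const_mul _ hφ]; gcongr
      _ = C₁ := mul_one _
  have i1 : ∫⁻ z, F 1 z ∂(μ.prod ν) ≤ C₂ := by
    change ∫⁻ z : α × β, B z.1 z.2 * ψ z.1 ∂(μ.prod ν) ≤ C₂
    rw [lintegral_prod _ (by fun_prop)]
    calc _ ≤ ∫⁻ X, C₂ * ψ X ∂μ := by
          refine lintegral_mono fun X => ?_
          dsimp only
          rw [lintegral_mul_const _ (hB.of_uncurry_left)]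
          gcongr
          exact h₂ X
      _ ≤ C₂ * 1 := by rw [lintegral_const_mul _ hψ]; gcongr
      _ = C₂ := mul_one _
  have i2 : ∫⁻ z, F 2 z ∂(μ.prod ν) ≤ 1 := by
    change ∫⁻ z : α × β, φ z.2 * ψ z.1 ∂(μ.prod ν) ≤ 1
    rw [lintegral_prod _ (by fun_prop)]
    calc _ ≤ ∫⁻ X, 1 * ψ X ∂μ := by
          refine lintegral_mono fun X => ?_
          dsimp only
          rw [lintegral_mul_const _ hφ]
          gcongr
      _ ≤ 1 := by simpa using iψ
  calc _ ≤ ∫⁻ X, ∫⁻ Y, F 0 (X, Y) ^ y * F 1 (X, Y) ^ (1 - x) * F 2 (X, Y) ^ (x - y) ∂ν ∂μ :=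
        lintegral_mono fun X => lintegral_mono fun Y => hpt X Y
    _ = ∫⁻ z, F 0 z ^ y * F 1 z ^ (1 - x) * F 2 z ^ (x - y) ∂(μ.prod ν) := by
        have := hFm 0
        have := hFm 1
        have := hFm 2
        rw [lintegral_prod _ (by fun_prop)]
    _ ≤ _ := hol
    _ ≤ C₁ ^ y * C₂ ^ (1 - x) * 1 ^ (x - y) := by gcongr
    _ = _ := by simp

/-- Passage from a bilinear bound for normalized functions to a bound for the integral operator. -/
theorem lintegral_operator_le_of_bilinear [SigmaFinite μ] [SFinite ν] {x y : ℝ} (hx : 0 < x)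
    (hy : 0 < y)
    (hy1 : y < 1) {k : α → β → ℝ≥0∞} (hk : Measurable (Function.uncurry k)) {C : ℝ≥0∞} (hC : C ≠ 0)
    (H : ∀ (φ : β → ℝ≥0∞) (ψ : α → ℝ≥0∞), Measurable φ → Measurable ψ → ∫⁻ Y, φ Y ∂ν ≤ 1 →
      ∫⁻ X, ψ X ∂μ ≤ 1 → ∫⁻ X, ∫⁻ Y, k X Y * φ Y ^ x * ψ X ^ (1 - y) ∂ν ∂μ ≤ C)
    {φ : β → ℝ≥0∞} (hφ : Measurable φ) :
    (∫⁻ X, (∫⁻ Y, k X Y * φ Y ^ x ∂ν) ^ (1 / y) ∂μ) ^ y ≤ C * (∫⁻ Y, φ Y ∂ν) ^ x := by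
  have hy1' : 0 < 1 - y := by linarith
  have mk : Measurable fun z : α × β => k z.1 z.2 := hk
  have key : ∀ φ : β → ℝ≥0∞, Measurable φ → ∫⁻ Y, φ Y ∂ν ≤ 1 →
      (∫⁻ X, (∫⁻ Y, k X Y * φ Y ^ x ∂ν) ^ (1 / y) ∂μ) ^ y ≤ C := by
    intro φ hφ iφ
    set T : α → ℝ≥0∞ := fun X => ∫⁻ Y, k X Y * φ Y ^ x ∂ν with hT
    have mT : Measurable T :=
      Measurable.lintegral_prod_right' (f := fun z : α × β => k z.1 z.2 * φ z.2 ^ x) (by fun_prop)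
    -- The extremal dual function `T ^ (1/y)`, cut off in size and to sets of finite measure. The
    -- cut-off makes `I = ∫ ψ j` finite, so that `ψ j` can be normalized. The bilinear bound then
    -- reads `I ^ y ≤ C`, and monotone convergence removes the cut-off.
    set ψ : ℕ → α → ℝ≥0∞ := fun j =>
      (spanningSets μ j).indicator fun X => (min (T X) j) ^ (1 / y) with hψ
    have mψ : ∀ j, Measurable (ψ j) := fun j =>
      Measurable.indicator (by fun_prop) (measurableSet_spanningSets μ j)
    have hle : ∀ j X, ψ j X ≤ T X * ψ j X ^ (1 - y) := by
      intro j X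
      by_cases hX : X ∈ spanningSets μ j
      · simp only [hψ, Set.indicator_of_mem hX]
        set m := min (T X) j
        calc m ^ (1 / y) = m * (m ^ (1 / y)) ^ (1 - y) := by
              rw [← ENNReal.rpow_mul]
              nth_rw 2 [← ENNReal.rpow_one m]
              rw [← ENNReal.rpow_add_of_nonneg _ _ (by norm_num) (by positivity)]
              congr 1; field_simp; ring
          _ ≤ T X * (m ^ (1 / y)) ^ (1 - y) := by gcongr; exact min_le_left _ _
      · simp [hψ, Set.indicator_of_notMem hX]
    have hI : ∀ j, ∫⁻ X, ψ j X ∂μ ≤ C ^ (1 / y) := by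
      intro j
      set I := ∫⁻ X, ψ j X ∂μ with hIdef
      rcases eq_or_ne I 0 with h0 | h0
      · rw [h0]; positivity
      have hfin : I ≠ ⊤ := by
        refine ne_top_of_le_ne_top (b := (j : ℝ≥0∞) ^ (1 / y) * μ (spanningSets μ j))
          (ENNReal.mul_ne_top (by simp [ENNReal.rpow_eq_top_iff, hy.le])
            (measure_spanningSets_lt_top μ j).ne) ?_
        rw [hIdef, hψ, lintegral_indicator (measurableSet_spanningSets μ j), ← setLIntegral_const]
        refine lintegral_mono fun X => ?_
        gcongr
        exact min_le_right _ _
      have h1 := H φ (fun X => I⁻¹ * ψ j X) hφ (by fun_prop) iφ (by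
        rw [lintegral_const_mul _ (mψ j), ENNReal.inv_mul_cancel h0 hfin])
      have h2 : I⁻¹ ^ (1 - y) * I ≤ C := by
        refine le_trans ?_ h1
        rw [hIdef, ← lintegral_const_mul _ (mψ j)]
        refine lintegral_mono fun X => ?_
        dsimp only
        rw [lintegral_mul_const _ (by have := mk.of_uncurry_left (x := X); fun_prop),
          ENNReal.mul_rpow_of_nonneg _ _ hy1'.le]
        change _ ≤ T X * _
        rw [mul_left_comm]
        gcongr
        exact hle j X
      have h3 : I⁻¹ ^ (1 - y) * I = I ^ y := by
        rw [ENNReal.inv_rpow, ← ENNReal.rpow_neg]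
        nth_rw 2 [← ENNReal.rpow_one I]
        rw [← ENNReal.rpow_add _ _ h0 hfin]
        congr 1; ring
      rw [h3] at h2
      rw [one_div]
      exact (ENNReal.le_rpow_inv_iff hy).2 h2
    have hmono : Monotone ψ := by
      intro i j hij X
      refine (Set.indicator_le_indicator_of_subset (monotone_spanningSets μ hij)
        (fun _ => bot_le) X).trans ?_
      refine Set.indicator_le_indicator ?_
      gcongr
    have hsup : ∀ X, T X ^ (1 / y) = ⨆ j, ψ j X := by
      intro X
      refine le_antisymm ?_ ?_
      · obtain ⟨i, hi⟩ : ∃ i, X ∈ spanningSets μ i := by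
          exact Set.mem_iUnion.1 ((iUnion_spanningSets μ).symm ▸ Set.mem_univ X)
        have hlim : Tendsto (fun j : ℕ => (min (T X) j) ^ (1 / y)) atTop (𝓝 (T X ^ (1 / y))) := by
          refine (ENNReal.continuous_rpow_const.tendsto _).comp ?_
          have : Tendsto (fun j : ℕ => (min (T X) (j : ℝ≥0∞))) atTop (𝓝 (min (T X) ⊤)) :=
            tendsto_const_nhds.min ENNReal.tendsto_nat_nhds_top
          simpa using this
        refine le_of_tendsto hlim ?_
        filter_upwards [eventually_ge_atTop i] with j hj
        refine le_trans ?_ (le_iSup (fun j => ψ j X) j)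
        simp only [hψ]
        rw [Set.indicator_of_mem (monotone_spanningSets μ hj hi)]
      · refine iSup_le fun j => ?_
        refine (Set.indicator_le_self _ _ _).trans ?_
        dsimp only
        gcongr
        exact min_le_left _ _
    have : ∫⁻ X, T X ^ (1 / y) ∂μ ≤ C ^ (1 / y) := by
      simp_rw [hsup]
      rw [lintegral_iSup mψ hmono]
      exact iSup_le hI
    rw [one_div] at this
    have := (ENNReal.le_rpow_inv_iff hy).1 this
    simpa using this
  set I := ∫⁻ Y, φ Y ∂ν with hI
  rcases eq_or_ne I 0 with h0 | h0
  · have h1 : φ =ᵐ[ν] 0 := (lintegral_eq_zero_iff hφ).1 h0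
    have h2 : ∀ X, ∫⁻ Y, k X Y * φ Y ^ x ∂ν = 0 := by
      intro X
      rw [← lintegral_zero (μ := ν)]
      refine lintegral_congr_ae ?_
      filter_upwards [h1] with Y hY
      simp [hY, hx]
    simp [h2, hy]
  rcases eq_or_ne I ⊤ with ht | ht
  · rw [ht, ENNReal.top_rpow_of_pos hx, ENNReal.mul_top hC]; exact le_top
  have h1 := key (fun Y => I⁻¹ * φ Y) (by fun_prop) (by
    rw [lintegral_const_mul _ hφ, ENNReal.inv_mul_cancel h0 ht])
  have hI0 : I⁻¹ ^ x ≠ ⊤ := by simp [ENNReal.rpow_eq_top_iff, h0, ht]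
  have h2 : ∀ X, ∫⁻ Y, k X Y * (I⁻¹ * φ Y) ^ x ∂ν = I⁻¹ ^ x * ∫⁻ Y, k X Y * φ Y ^ x ∂ν := by
    intro X
    rw [← lintegral_const_mul' _ _ hI0]
    refine lintegral_congr fun Y => ?_
    rw [ENNReal.mul_rpow_of_nonneg _ _ hx.le]; ring
  simp_rw [h2, ENNReal.mul_rpow_of_nonneg _ _ (by positivity : 0 ≤ 1 / y)] at h1
  rw [lintegral_const_mul' _ _ (by simp [ENNReal.rpow_eq_top_iff, h0, ht]),
    ENNReal.mul_rpow_of_nonneg _ _ hy.le, ← ENNReal.rpow_mul, one_div, inv_mul_cancel₀ hy.ne',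
    ENNReal.rpow_one, ENNReal.inv_rpow] at h1
  rw [mul_comm C, ← ENNReal.inv_mul_le_iff (by simp [h0, ht, hx])
    (by simp [ENNReal.rpow_eq_top_iff, h0, ht])]
  simpa using h1

end Schur

/-! ### Geometry of the half space and integrals of power weights. -/

section HalfSpace

variable {n : ℕ}

theorem continuous_height : Continuous (height : HalfAmbient n → ℝ) := by
  unfold height; fun_prop

@[fun_prop]
theorem measurable_height : Measurable (height : HalfAmbient n → ℝ) :=
  continuous_height.measurable

theorem isOpen_halfSpace : IsOpen (halfSpace n) :=
  isOpen_lt continuous_const continuous_height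

theorem measurableSet_halfSpace : MeasurableSet (halfSpace n) :=
  isOpen_halfSpace.measurableSet

@[simp] theorem height_add (X Y : HalfAmbient n) : height (X + Y) = height X + height Y := rfl

@[simp] theorem height_sub (X Y : HalfAmbient n) : height (X - Y) = height X - height Y := rfl

@[simp] theorem height_smul (c : ℝ) (X : HalfAmbient n) : height (c • X) = c * height X := rfl

@[simp] theorem height_eLast : height (eLast n) = 1 := by simp [height, eLast]

@[simp] theorem norm_eLast : ‖eLast n‖ = 1 := by simp [eLast]

theorem abs_height_le (X : HalfAmbient n) : |height X| ≤ ‖X‖ := by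
  simpa [height] using PiLp.norm_apply_le X (Fin.last n)

theorem finrank_halfAmbient : (Module.finrank ℝ (HalfAmbient n) : ℝ) = n + 1 := by
  simp [HalfAmbient]

/-- The orthogonal projection to the boundary `{t = 0}`. -/
noncomputable def bdryProj (X : HalfAmbient n) : HalfAmbient n := X - height X • eLast n

@[simp] theorem height_bdryProj (X : HalfAmbient n) : height (bdryProj X) = 0 := by
  simp [bdryProj]

@[fun_prop]
theorem continuous_bdryProj : Continuous (bdryProj : HalfAmbient n → HalfAmbient n) := by
  have := continuous_height (n := n)
  unfold bdryProj; fun_prop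

@[fun_prop]
theorem measurable_bdryProj : Measurable (bdryProj : HalfAmbient n → HalfAmbient n) :=
  continuous_bdryProj.measurable

theorem norm_sub_bdryProj (X : HalfAmbient n) : ‖X - bdryProj X‖ = |height X| := by
  simp [bdryProj, norm_smul]

theorem lintegral_rpow_mul_one_add_rpow_ne_top {a d : ℝ} (ha : -1 < a) (hd : a + 1 < d) :
    ∫⁻ t in Set.Ioi (0 : ℝ), ENNReal.ofReal (t ^ a * (1 + t) ^ (-d)) ≠ ⊤ := by
  have hd0 : 0 < d := by linarith
  rw [← Set.Ioc_union_Ioi_eq_Ioi zero_le_one]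
  refine ne_top_of_le_ne_top ?_ (lintegral_union_le _ _ _)
  refine ENNReal.add_ne_top.2 ⟨?_, ?_⟩
  · have h1 : IntegrableOn (fun t : ℝ => t ^ a) (Set.Ioc 0 1) := by
      rw [← intervalIntegrable_iff_integrableOn_Ioc_of_le zero_le_one]
      exact intervalIntegral.intervalIntegrable_rpow' ha
    refine ne_top_of_le_ne_top h1.setLIntegral_lt_top.ne ?_
    refine setLIntegral_mono' measurableSet_Ioc fun t ht => ENNReal.ofReal_le_ofReal ?_
    have ht0 : 0 < t := ht.1
    refine mul_le_of_le_one_right (by positivity) ?_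
    exact Real.rpow_le_one_of_one_le_of_nonpos (by linarith) (by linarith)
  · have h1 : IntegrableOn (fun t : ℝ => t ^ (a - d)) (Set.Ioi 1) :=
      integrableOn_Ioi_rpow_of_lt (by linarith) one_pos
    refine ne_top_of_le_ne_top h1.setLIntegral_lt_top.ne ?_
    refine setLIntegral_mono' measurableSet_Ioi fun t ht => ENNReal.ofReal_le_ofReal ?_
    have ht0 : 0 < t := lt_trans one_pos ht
    rw [sub_eq_add_neg, Real.rpow_add ht0]
    gcongr ?_ * ?_
    exact Real.rpow_le_rpow_of_nonpos ht0 (by linarith) (by linarith)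

/-- The coordinates `(t, x)` of a point of the half space, as a measurable equivalence. -/
noncomputable def splitCoord (n : ℕ) : HalfAmbient n ≃ᵐ ℝ × (Fin n → ℝ) :=
  (MeasurableEquiv.toLp 2 (Fin (n + 1) → ℝ)).symm.trans
    (MeasurableEquiv.piFinSuccAbove (fun _ => ℝ) (Fin.last n))

theorem measurePreserving_splitCoord : MeasurePreserving (splitCoord n) :=
  (volume_preserving_piFinSuccAbove (fun _ => ℝ) (Fin.last n)).comp
    (EuclideanSpace.volume_preserving_symm_measurableEquiv_toLp (Fin (n + 1)))

theorem splitCoord_fst (X : HalfAmbient n) : (splitCoord n X).1 = height X := rfl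

theorem norm_splitCoord_snd_le (X : HalfAmbient n) : ‖(splitCoord n X).2‖ ≤ ‖X‖ := by
  refine (pi_norm_le_iff_of_nonneg (norm_nonneg _)).2 fun i => ?_
  exact PiLp.norm_apply_le X ((Fin.last n).succAbove i)

/-- The surplus decay `d - (n + 1 + a) = 2ε` is shared equally between the height and the tangential
variables. Since `‖X‖` dominates both, the integrand is bounded by a product and Tonelli applies. -/
theorem lintegral_halfSpace_rpow_ne_top {a d : ℝ} (ha : -1 < a) (hd : n + 1 + a < d) :
    ∫⁻ X in halfSpace n, ENNReal.ofReal (height X ^ a * (1 + ‖X‖) ^ (-d)) ≠ ⊤ := by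
  set ε := (d - (n + 1 + a)) / 2 with hε
  have hε0 : 0 < ε := by rw [hε]; linarith
  set d₁ := n + ε with hd₁
  set d₂ := a + 1 + ε with hd₂
  have hsum : d = d₂ + d₁ := by rw [hd₁, hd₂, hε]; ring
  have hd1 : 0 < d₁ := by positivity
  have hd2 : 0 < d₂ := by linarith
  have f1 := lintegral_rpow_mul_one_add_rpow_ne_top ha (d := d₂) (by linarith)
  have f2 := (finite_integral_one_add_norm (E := Fin n → ℝ) (μ := volume) (r := d₁)
    (by simp; linarith)).ne
  set g : ℝ × (Fin n → ℝ) → ℝ≥0∞ := fun z =>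
    (Set.Ioi (0 : ℝ)).indicator (fun t => ENNReal.ofReal (t ^ a * (1 + t) ^ (-d₂))) z.1 *
      ENNReal.ofReal ((1 + ‖z.2‖) ^ (-d₁)) with hg
  have hgi : ∫⁻ z, g z ≠ ⊤ := by
    rw [Measure.volume_eq_prod, show g = fun z => _ from hg, lintegral_prod_mul
      (f := (Set.Ioi (0 : ℝ)).indicator (fun t => ENNReal.ofReal (t ^ a * (1 + t) ^ (-d₂))))
      (g := fun x : Fin n → ℝ => ENNReal.ofReal ((1 + ‖x‖) ^ (-d₁)))
      ((Measurable.indicator (by fun_prop) measurableSet_Ioi).aemeasurable)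
      (by fun_prop), lintegral_indicator measurableSet_Ioi]
    exact ENNReal.mul_ne_top f1 f2
  rw [← (measurePreserving_splitCoord (n := n)).lintegral_comp_emb
    (splitCoord n).measurableEmbedding] at hgi
  refine ne_top_of_le_ne_top hgi ?_
  rw [← lintegral_indicator measurableSet_halfSpace]
  refine lintegral_mono fun X => ?_
  by_cases hX : X ∈ halfSpace n
  · have h0 : 0 < height X := hX
    rw [Set.indicator_of_mem hX, hg]
    dsimp only
    rw [splitCoord_fst, Set.indicator_of_mem (by exact h0),
      ← ENNReal.ofReal_mul (by positivity)]
    refine ENNReal.ofReal_le_ofReal ?_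
    rw [hsum, neg_add, Real.rpow_add (by positivity), mul_assoc]
    gcongr ?_ * (?_ * ?_)
    · exact Real.rpow_le_rpow_of_nonpos (by positivity)
        (by linarith [le_abs_self (height X), abs_height_le X]) (by linarith)
    · exact Real.rpow_le_rpow_of_nonpos (by positivity)
        (by linarith [norm_splitCoord_snd_le X]) (by linarith)
  · rw [Set.indicator_of_notMem hX]; exact bot_le

/-- Translation along the boundary and dilation by `s` preserve the half space, which reduces to `s
= 1`, `Z = 0`. -/
theorem exists_lintegral_halfSpace_rpow_le {a d : ℝ} (ha : -1 < a) (hd : n + 1 + a < d) :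
    ∃ C : ℝ≥0∞, C ≠ ⊤ ∧ ∀ (s : ℝ) (Z : HalfAmbient n), 0 < s → height Z = 0 →
      ∫⁻ X in halfSpace n, ENNReal.ofReal (height X ^ a * (s + ‖X - Z‖) ^ (-d)) ≤
        C * ENNReal.ofReal (s ^ (a + (n + 1) - d)) := by
  refine ⟨_, lintegral_halfSpace_rpow_ne_top ha hd, fun s Z hs hZ => le_of_eq ?_⟩
  rw [← lintegral_indicator measurableSet_halfSpace, ← lintegral_indicator measurableSet_halfSpace,
    ← lintegral_add_right_eq_self _ Z, lintegral_eq_lintegral_comp_smul volume hs,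
    ← lintegral_const_mul' _ _ ENNReal.ofReal_ne_top, ← lintegral_mul_const' _ _ ENNReal.ofReal_ne_top]
  refine lintegral_congr fun X => ?_
  by_cases hX : 0 < height X
  · rw [Set.indicator_of_mem (by simp [halfSpace, hX, hs, hZ]), Set.indicator_of_mem (by exact hX),
      finrank_halfAmbient, ← ENNReal.ofReal_mul (by positivity), ← ENNReal.ofReal_mul (by positivity)]
    congr 1
    have h1 : height (s • X + Z) = s * height X := by simp [hZ]
    have h2 : s + ‖s • X + Z - Z‖ = s * (1 + ‖X‖) := by
      rw [add_sub_cancel_right, norm_smul, Real.norm_of_nonneg hs.le]; ring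
    have h3 : s ^ (a + (n + 1) - d) = s ^ ((n : ℝ) + 1) * s ^ a * s ^ (-d) := by
      rw [← Real.rpow_add hs, ← Real.rpow_add hs]; congr 1; ring
    rw [h1, h2, Real.mul_rpow hs.le hX.le, Real.mul_rpow hs.le (by positivity), h3]
    ring
  · rw [Set.indicator_of_notMem (by simpa [halfSpace, hs, hZ] using hX),
      Set.indicator_of_notMem (by exact hX)]
    simp

end HalfSpace

/-! ### Weighted Riesz potentials on the half space. -/

section Weighted

variable {n : ℕ}

theorem rpow_le_two_rpow_abs {z e : ℝ} (h1 : 1 / 2 ≤ z) (h2 : z ≤ 2) : z ^ e ≤ 2 ^ |e| := by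
  have hz : 0 < z := by linarith
  rcases le_total 0 e with he | he
  · rw [abs_of_nonneg he]
    exact Real.rpow_le_rpow hz.le h2 he
  · rw [abs_of_nonpos he, Real.rpow_neg (by norm_num), ← Real.inv_rpow (by norm_num)]
    exact Real.rpow_le_rpow_of_nonpos (by norm_num) (by linarith) he

/-- When `2ρ < t`, the ratio `s/t` lies in `[1/2, 2]`, so the weights amount to `t ^ (b - a)`, which
is at most `ρ ^ (b - a)` because `b ≤ a`. The condition `e ≠ 0` covers `ρ = 0`, where `0 ^ e = 0`.
-/
theorem weighted_kernel_near_le {t s ρ a b e l : ℝ} (ht : 0 < t) (hs : 0 < s) (hρ : 0 ≤ ρ)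
    (hts : |t - s| ≤ ρ) (hρt : 2 * ρ < t) (hab : b ≤ a) (he : e ≠ 0) (hl : e = l + (a - b)) :
    t ^ b * s ^ (-a) * ρ ^ e ≤ 2 ^ |a| * ρ ^ l := by
  rcases hρ.eq_or_lt with h0 | h0
  · rw [← h0, Real.zero_rpow he]; simp only [mul_zero]; positivity
  have h := abs_le.1 hts
  have h1 : (s / t) ^ (-a) ≤ 2 ^ |a| := by
    rw [← abs_neg a]
    refine rpow_le_two_rpow_abs ?_ ?_
    · rw [le_div_iff₀ ht]; linarith
    · rw [div_le_iff₀ ht]; linarith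
  have h2 : t ^ (b - a) ≤ ρ ^ (b - a) :=
    Real.rpow_le_rpow_of_nonpos h0 (by linarith) (by linarith)
  have h3 : t ^ b * s ^ (-a) = (s / t) ^ (-a) * t ^ (b - a) := by
    rw [Real.div_rpow hs.le ht.le, Real.rpow_sub ht, Real.rpow_neg ht.le, Real.rpow_neg hs.le]
    have : 0 < t ^ a := by positivity
    have : 0 < s ^ a := by positivity
    field_simp
  calc t ^ b * s ^ (-a) * ρ ^ e = (s / t) ^ (-a) * t ^ (b - a) * ρ ^ e := by rw [h3]
    _ ≤ 2 ^ |a| * ρ ^ (b - a) * ρ ^ e := by gcongr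
    _ = 2 ^ |a| * ρ ^ l := by
      rw [mul_assoc, ← Real.rpow_add h0]; congr 2; rw [hl]; ring

/-- Away from the diagonal `ρ` dominates the lengths `v` and `w`, so a negative power of `ρ` may be
replaced by the same power of either. Splitting it into a `y`-part and an `x`-part gives the
factored form that the Schur test requires. -/
theorem weighted_kernel_far_le {t s ρ v w a b d x y α₁ β₁ α₂ β₂ : ℝ} (ht : 0 < t) (hs : 0 < s)
    (hρ : 0 < ρ) (hv : 0 < v) (hw : 0 < w) (hvρ : v ≤ 7 * ρ) (hwρ : w ≤ 7 * ρ) (hd : 0 ≤ d)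
    (hy : 0 ≤ y) (hx : 0 ≤ x) (hb : α₁ * y + β₂ * x = b) (ha : β₁ * y + α₂ * x = a) :
    t ^ b * s ^ a * ρ ^ (-(d * (y + x))) ≤
      (t ^ α₁ * s ^ β₁ * (7 ^ d * v ^ (-d))) ^ y * (t ^ β₂ * s ^ α₂ * (7 ^ d * w ^ (-d))) ^ x := by
  have key : ∀ {v : ℝ}, 0 < v → v ≤ 7 * ρ → ρ ^ (-d) ≤ 7 ^ d * v ^ (-d) := by
    intro v hv hvρ
    have h1 : (7 * ρ) ^ (-d) ≤ v ^ (-d) := Real.rpow_le_rpow_of_nonpos hv hvρ (by linarith)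
    calc ρ ^ (-d) = 7 ^ d * (7 * ρ) ^ (-d) := by
          rw [Real.mul_rpow (by norm_num) hρ.le, ← mul_assoc, ← Real.rpow_add (by norm_num)]
          simp
      _ ≤ _ := by gcongr
  calc t ^ b * s ^ a * ρ ^ (-(d * (y + x)))
      = (t ^ α₁ * s ^ β₁ * ρ ^ (-d)) ^ y * (t ^ β₂ * s ^ α₂ * ρ ^ (-d)) ^ x := by
        rw [Real.mul_rpow (by positivity) (by positivity), Real.mul_rpow (by positivity) (by positivity),
          Real.mul_rpow (by positivity) (by positivity), Real.mul_rpow (by positivity) (by positivity),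
          ← Real.rpow_mul ht.le, ← Real.rpow_mul ht.le, ← Real.rpow_mul hs.le,
          ← Real.rpow_mul hs.le, ← Real.rpow_mul hρ.le, ← Real.rpow_mul hρ.le, ← hb, ← ha,
          Real.rpow_add ht, Real.rpow_add hs,
          show -(d * (y + x)) = -d * y + -d * x by ring, Real.rpow_add hρ]
        ring
    _ ≤ _ := by
      have := key hv hvρ
      have := key hw hwρ
      gcongr

/-- The weighted Riesz kernel `t ^ b * s ^ (-a) * |X - Y| ^ (-l)` on the half space, where `t` and
`s` are the heights of `X` and `Y`. -/
noncomputable def weightedKernel (a b l : ℝ) (X Y : HalfAmbient n) : ℝ≥0∞ :=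
  {z : HalfAmbient n × HalfAmbient n | 0 < height z.1 ∧ 0 < height z.2}.indicator
    (fun z => ENNReal.ofReal (height z.1 ^ b * height z.2 ^ (-a) * ‖z.1 - z.2‖ ^ (-l))) (X, Y)

theorem measurableSet_height_pos_prod :
    MeasurableSet {z : HalfAmbient n × HalfAmbient n | 0 < height z.1 ∧ 0 < height z.2} :=
  measurableSet_halfSpace.prod measurableSet_halfSpace

theorem measurable_weightedKernel (a b l : ℝ) :
    Measurable (Function.uncurry (weightedKernel (n := n) a b l)) := by
  change Measurable (Set.indicator _ _)
  exact Measurable.indicator (by fun_prop) measurableSet_height_pos_prod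

theorem weightedKernel_of_pos {a b l : ℝ} {X Y : HalfAmbient n} (hX : 0 < height X)
    (hY : 0 < height Y) : weightedKernel a b l X Y =
      ENNReal.ofReal (height X ^ b * height Y ^ (-a) * ‖X - Y‖ ^ (-l)) :=
  Set.indicator_of_mem (by exact ⟨hX, hY⟩) _

theorem weightedKernel_of_not {a b l : ℝ} {X Y : HalfAmbient n}
    (h : ¬ (0 < height X ∧ 0 < height Y)) : weightedKernel a b l X Y = 0 :=
  Set.indicator_of_notMem (by exact h) _

/-- Majorant used in the Schur test for the part of the weighted Riesz kernel away from the
diagonal. -/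
noncomputable def schurMajorant (α d : ℝ) (X Y : HalfAmbient n) : ℝ≥0∞ :=
  {z : HalfAmbient n × HalfAmbient n | 0 < height z.1 ∧ 0 < height z.2}.indicator
    (fun z => ENNReal.ofReal (height z.1 ^ α * height z.2 ^ (-(α + (n + 1) - d)) *
      (7 ^ d * (height z.2 + ‖z.1 - bdryProj z.2‖) ^ (-d)))) (X, Y)

theorem measurable_schurMajorant (α d : ℝ) :
    Measurable (Function.uncurry (schurMajorant (n := n) α d)) := by
  change Measurable (Set.indicator _ _)
  exact Measurable.indicator (by fun_prop) measurableSet_height_pos_prod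

/-- The power of `height Y` in the majorant is the one that cancels the scaling of the integral in
`X`, which makes the bound uniform in `Y`. -/
theorem exists_lintegral_schurMajorant_le {α d : ℝ} (hα : -1 < α) (hd : n + 1 + α < d) :
    ∃ C : ℝ≥0∞, C ≠ ⊤ ∧ ∀ Y : HalfAmbient n, ∫⁻ X, schurMajorant α d X Y ≤ C := by
  obtain ⟨C, hC, h⟩ := exists_lintegral_halfSpace_rpow_le hα hd
  refine ⟨ENNReal.ofReal (7 ^ d) * C, ENNReal.mul_ne_top (by simp) hC, fun Y => ?_⟩
  by_cases hY : 0 < height Y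
  · have h1 := h (height Y) (bdryProj Y) hY (height_bdryProj Y)
    have h2 : ∀ X, schurMajorant α d X Y =
        ENNReal.ofReal (7 ^ d * height Y ^ (-(α + (n + 1) - d))) * (halfSpace n).indicator
        (fun X => ENNReal.ofReal (height X ^ α * (height Y + ‖X - bdryProj Y‖) ^ (-d))) X := by
      intro X
      by_cases hX : 0 < height X
      · rw [schurMajorant, Set.indicator_of_mem (by exact ⟨hX, hY⟩),
          Set.indicator_of_mem (by exact hX), ← ENNReal.ofReal_mul (by positivity)]
        congr 1; ring
      · rw [schurMajorant, Set.indicator_of_notMem (fun h => hX h.1),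
          Set.indicator_of_notMem (by exact hX), mul_zero]
    simp_rw [h2]
    rw [lintegral_const_mul' _ _ ENNReal.ofReal_ne_top, lintegral_indicator measurableSet_halfSpace]
    refine (mul_le_mul_right h1 _).trans (le_of_eq ?_)
    rw [ENNReal.ofReal_mul (by positivity), mul_assoc, mul_left_comm _ C,
      ENNReal.ofReal_rpow_mul_rpow hY, neg_add_cancel]
    simp
  · have h2 : ∀ X, schurMajorant α d X Y = 0 := fun X =>
      Set.indicator_of_notMem (fun h => hY h.2) _
    simp [h2]

/-- Boundedness of the weighted Riesz potential on the half space, from `L^(1/x)` to `L^(1/y)`. -/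
theorem exists_weightedKernel_bound {x y a b l : ℝ} (hy : 0 < y) (hyx : y < x) (hx : x < 1)
    (hab : b ≤ a) (hb : -y < b) (ha : a < 1 - x) (hl0 : 0 < l)
    (hl : l = (n + 1) * (1 - x + y) + b - a) :
    ∃ C : ℝ≥0∞, C ≠ ⊤ ∧ ∀ φ : HalfAmbient n → ℝ≥0∞, Measurable φ →
      (∫⁻ X, (∫⁻ Y, weightedKernel a b l X Y * φ Y ^ x) ^ (1 / y)) ^ y ≤
        C * (∫⁻ Y, φ Y) ^ x := by
  have hx' : 0 < 1 - x := by linarith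
  have hy1 : y < 1 := by linarith
  have hx0 : 0 < x := by linarith
  set κ := 1 - x + y with hκdef
  have hκ : 0 < κ := by linarith
  -- `h` is the free parameter distributing the weights between the two Schur majorants. Its four
  -- bounds are, for `α₁` and `α₂`, integrability at the boundary (`> -1`) and at infinity (`n + 1 +
  -- αᵢ < d`). They are compatible because `y (1 - x)` satisfies all four, by `a < 1 - x` and `-y <
  -- b`.
  obtain ⟨h, hh1, hh2⟩ : ∃ h, max (a * y) (-b * (1 - x)) < h ∧
      h < min ((κ + b) * y) ((κ - a) * (1 - x)) := by
    refine exists_between (max_lt (lt_min ?_ ?_) (lt_min ?_ ?_))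
    · nlinarith
    · nlinarith
    · nlinarith
    · nlinarith
  obtain ⟨h1, h2⟩ := max_lt_iff.1 hh1
  obtain ⟨h3, h4⟩ := lt_min_iff.1 hh2
  set d := l / κ with hd
  have hdκ : d * κ = l := by rw [hd]; field_simp
  have hd0 : 0 < d := by positivity
  set α₁ := (b - h / y) / κ with hα₁
  set α₂ := (-a - h / (1 - x)) / κ with hα₂
  have e1 : h / y < κ + b := by rw [div_lt_iff₀ hy]; exact h3
  have e2 : a < h / y := by rw [lt_div_iff₀ hy]; exact h1
  have e3 : h / (1 - x) < κ - a := by rw [div_lt_iff₀ hx']; exact h4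
  have e4 : -b < h / (1 - x) := by rw [lt_div_iff₀ hx']; exact h2
  obtain ⟨C₁, hC₁, H₁⟩ := exists_lintegral_schurMajorant_le (n := n) (α := α₁) (d := d)
    (by rw [hα₁, lt_div_iff₀ hκ]; linarith)
    (by
      have : (n : ℝ) + 1 + α₁ = ((n + 1) * κ + b - h / y) / κ := by rw [hα₁]; field_simp; ring
      rw [this, hd, hl]; gcongr)
  obtain ⟨C₂, hC₂, H₂⟩ := exists_lintegral_schurMajorant_le (n := n) (α := α₂) (d := d)
    (by rw [hα₂, lt_div_iff₀ hκ]; linarith)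
    (by
      have : (n : ℝ) + 1 + α₂ = ((n + 1) * κ - h / (1 - x) - a) / κ := by
        rw [hα₂]; field_simp; ring
      rw [this, hd, hl]
      refine div_lt_div_of_pos_right ?_ hκ
      linarith)
  obtain ⟨C₃, hC₃, H₃⟩ := exists_hardyLittlewoodSobolev (volume : Measure (HalfAmbient n))
    (by simp) hx hy hyx
  simp only [finrank_halfAmbient, ← hκdef] at H₃
  set A : HalfAmbient n → HalfAmbient n → ℝ≥0∞ := schurMajorant α₁ d with hA
  set B : HalfAmbient n → HalfAmbient n → ℝ≥0∞ := fun X Y => schurMajorant α₂ d Y X with hB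
  have mA : Measurable (Function.uncurry A) := measurable_schurMajorant _ _
  have mB : Measurable (Function.uncurry B) :=
    (measurable_schurMajorant (n := n) α₂ d).comp measurable_swap
  set c := ENNReal.ofReal (2 ^ |a|) with hc
  have hle : ∀ X Y : HalfAmbient n, weightedKernel a b l X Y ≤
      c * ENNReal.ofReal (‖X - Y‖ ^ (-((n + 1) * κ))) + A X Y ^ y * B X Y ^ (1 - x) := by
    intro X Y
    by_cases hXY : 0 < height X ∧ 0 < height Y
    swap
    · rw [weightedKernel_of_not hXY]; exact bot_le
    obtain ⟨hX, hY⟩ := hXY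
    rw [weightedKernel_of_pos hX hY]
    have hts : |height X - height Y| ≤ ‖X - Y‖ := abs_height_le (X - Y)
    have hts' := abs_le.1 hts
    -- Near the diagonal the Hardy–Littlewood–Sobolev kernel is the majorant; elsewhere `A ^ y * B ^
    -- (1 - x)` is.
    rcases lt_or_ge (2 * ‖X - Y‖) (height X) with hn | hf
    · refine le_add_right ?_
      rw [hc, ← ENNReal.ofReal_mul (by positivity)]
      refine ENNReal.ofReal_le_ofReal
        (weighted_kernel_near_le hX hY (norm_nonneg _) hts hn hab (by linarith) ?_)
      rw [hl]; ring
    · refine le_add_left ?_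
      have hρ : 0 < ‖X - Y‖ := by linarith
      have gA : A X Y = ENNReal.ofReal (height X ^ α₁ * height Y ^ (-(α₁ + (n + 1) - d)) *
          (7 ^ d * (height Y + ‖X - bdryProj Y‖) ^ (-d))) :=
        Set.indicator_of_mem (by exact ⟨hX, hY⟩) _
      have gB : B X Y = ENNReal.ofReal (height X ^ (-(α₂ + (n + 1) - d)) * height Y ^ α₂ *
          (7 ^ d * (height X + ‖Y - bdryProj X‖) ^ (-d))) := by
        rw [mul_comm (height X ^ _)]
        exact Set.indicator_of_mem (by exact ⟨hY, hX⟩) _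
      rw [gA, gB, ENNReal.ofReal_rpow_of_nonneg (by positivity) hy.le,
        ENNReal.ofReal_rpow_of_nonneg (by positivity) hx'.le, ← ENNReal.ofReal_mul (by positivity)]
      refine ENNReal.ofReal_le_ofReal ?_
      have n1 : ‖X - bdryProj Y‖ ≤ ‖X - Y‖ + height Y := by
        have := norm_sub_le_norm_sub_add_norm_sub X Y (bdryProj Y)
        rwa [norm_sub_bdryProj, abs_of_pos hY] at this
      have n2 : ‖Y - bdryProj X‖ ≤ ‖X - Y‖ + height X := by
        have := norm_sub_le_norm_sub_add_norm_sub Y X (bdryProj X)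
        rwa [norm_sub_bdryProj, abs_of_pos hX, norm_sub_rev Y X] at this
      have hlk : l = d * (y + (1 - x)) := by rw [← hdκ, hκdef]; ring
      rw [hlk]
      have hxk : 1 - x = κ - y := by rw [hκdef]; ring
      -- With `ρ = ‖X - Y‖` one has `t ≤ 2ρ`, hence `s ≤ 3ρ` and `s + ‖X - bdryProj Y‖ ≤ 2s + ρ ≤
      -- 7ρ`; this is the source of the constant `7`. The other length is at most `5ρ`.
      refine weighted_kernel_far_le hX hY hρ (by positivity) (by positivity) (by linarith)
        (by linarith) hd0.le hy.le hx'.le ?_ ?_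
      · have : -(α₂ + (n + 1) - d) = (b + h / (1 - x)) / κ := by
          rw [hα₂, hd, hl]; field_simp; ring
        rw [this, hα₁]
        field_simp
        rw [hκdef]; ring
      · have : -(α₁ + (n + 1) - d) = (-a + h / y) / κ := by
          rw [hα₁, hd, hl]; field_simp; ring
        rw [this, hα₂]
        field_simp
        rw [hκdef]; ring
  -- The summand `1` provides the nonzero constant needed for duality.
  refine ⟨c * C₃ + C₁ ^ y * C₂ ^ (1 - x) + 1, ?_, fun φ hφ =>
    lintegral_operator_le_of_bilinear hx0 hy hy1 (measurable_weightedKernel a b l) (by simp) ?_ hφ⟩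
  · have h1 : C₁ ^ y ≠ ⊤ := by simp [ENNReal.rpow_eq_top_iff, hC₁, hy.le]
    have h2 : C₂ ^ (1 - x) ≠ ⊤ := by simp [ENNReal.rpow_eq_top_iff, hC₂, hx.le]
    have h3 : c * C₃ ≠ ⊤ := ENNReal.mul_ne_top (by simp [hc]) hC₃
    exact ENNReal.add_ne_top.2 ⟨ENNReal.add_ne_top.2 ⟨h3, ENNReal.mul_ne_top h1 h2⟩, by simp⟩
  intro φ ψ hφ hψ iφ iψ
  have b1 := H₃ φ ψ hφ hψ iφ iψ
  have b2 := lintegral_bilinear_le_of_schur (μ := (volume : Measure (HalfAmbient n)))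
    (ν := (volume : Measure (HalfAmbient n))) hx.le hy.le hyx.le mA mB (fun X Y => le_rfl) H₁ H₂
    hφ hψ iφ iψ
  refine le_trans ?_ le_self_add
  calc ∫⁻ X, ∫⁻ Y, weightedKernel a b l X Y * φ Y ^ x * ψ X ^ (1 - y)
      ≤ ∫⁻ X, ∫⁻ Y, (c * (ENNReal.ofReal (‖X - Y‖ ^ (-((n + 1) * κ))) * φ Y ^ x * ψ X ^ (1 - y)) +
          A X Y ^ y * B X Y ^ (1 - x) * φ Y ^ x * ψ X ^ (1 - y)) := by
        refine lintegral_mono fun X => lintegral_mono fun Y => ?_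
        calc _ ≤ (c * ENNReal.ofReal (‖X - Y‖ ^ (-((n + 1) * κ))) + A X Y ^ y * B X Y ^ (1 - x)) *
              φ Y ^ x * ψ X ^ (1 - y) := by gcongr; exact hle X Y
          _ = _ := by ring
    _ = c * (∫⁻ X, ∫⁻ Y, ENNReal.ofReal (‖X - Y‖ ^ (-((n + 1) * κ))) * φ Y ^ x * ψ X ^ (1 - y)) +
        ∫⁻ X, ∫⁻ Y, A X Y ^ y * B X Y ^ (1 - x) * φ Y ^ x * ψ X ^ (1 - y) := by
        have hct : c ≠ ⊤ := by simp [hc]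
        rw [← lintegral_const_mul' _ _ hct, ← lintegral_add_left]
        · refine lintegral_congr fun X => ?_
          rw [← lintegral_const_mul' _ _ hct, lintegral_add_left (by fun_prop)]
        · refine Measurable.const_mul ?_ _
          exact Measurable.lintegral_prod_right' (f := fun z : HalfAmbient n × HalfAmbient n =>
            ENNReal.ofReal (‖z.1 - z.2‖ ^ (-((n + 1) * κ))) * φ z.2 ^ x * ψ z.1 ^ (1 - y))
            (by fun_prop)
    _ ≤ c * C₃ + C₁ ^ y * C₂ ^ (1 - x) := by gcongr

/-- Weighted Hardy–Littlewood–Sobolev inequality on the half space, for functions dominated by a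
Riesz potential of order `r`. -/
theorem exists_wInt_le_of_riesz_bound {x y a b r : ℝ} (hy : 0 < y) (hyx : y < x) (hx : x < 1)
    (hab : b ≤ a) (hb : -y < b) (ha : a < 1 - x) (hr : r < n + 1)
    (hs : (n + 1) * x + a - r = (n + 1) * y + b) {c : ℝ≥0∞} (hc : c ≠ ⊤) :
    ∃ C : ℝ≥0∞, C ≠ ⊤ ∧ ∀ {V : Type} [NormedAddCommGroup V] (u : HalfAmbient n → ℝ)
      (v : HalfAmbient n → V), Measurable (fun Y => ‖v Y‖ₑ) →
      (∀ X ∈ halfSpace n, ‖u X‖ₑ ≤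
        c * ∫⁻ Y in halfSpace n, ENNReal.ofReal (‖X - Y‖ ^ (r - (n + 1))) * ‖v Y‖ₑ) →
      wInt (b / y) (1 / y) u ^ y ≤ C * wInt (a / x) (1 / x) v ^ x := by
  have hx0 : 0 < x := by linarith
  obtain ⟨C, hC, H⟩ := exists_weightedKernel_bound (n := n) (l := n + 1 - r) hy hyx hx hab hb ha
    (by linarith) (by linarith)
  refine ⟨c * C, ENNReal.mul_ne_top hc hC, fun {V} _ u v hv huv => ?_⟩
  -- Chosen so that `s ^ (-a) * φ ^ x = ‖v‖` on the half space, while `∫ φ` is the weighted integral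
  -- of `v`.
  set φ : HalfAmbient n → ℝ≥0∞ := (halfSpace n).indicator fun Y =>
    ENNReal.ofReal (height Y ^ (a / x)) * ‖v Y‖ₑ ^ (1 / x) with hφ
  have mφ : Measurable φ := Measurable.indicator (by fun_prop) measurableSet_halfSpace
  have h1 := H φ mφ
  have h2 : ∫⁻ Y, φ Y = wInt (a / x) (1 / x) v := by
    rw [hφ, lintegral_indicator measurableSet_halfSpace, wInt]
  rw [h2] at h1
  rw [mul_assoc]
  refine le_trans ?_ (mul_le_mul_right h1 c)
  have hcy : c = (c ^ (1 / y)) ^ y := by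
    rw [← ENNReal.rpow_mul, one_div, inv_mul_cancel₀ hy.ne', ENNReal.rpow_one]
  conv_rhs => rw [hcy, ← ENNReal.mul_rpow_of_nonneg _ _ hy.le, ← lintegral_const_mul' _ _
    (by simp [ENNReal.rpow_eq_top_iff, hc, hy.le])]
  gcongr
  rw [wInt, ← lintegral_indicator measurableSet_halfSpace]
  refine lintegral_mono fun X => ?_
  by_cases hX : X ∈ halfSpace n
  swap
  · rw [Set.indicator_of_notMem hX]; exact bot_le
  have hX0 : 0 < height X := hX
  rw [Set.indicator_of_mem hX]
  have h3 : ENNReal.ofReal (height X ^ (b / y)) = ENNReal.ofReal (height X ^ b) ^ (1 / y) := by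
    rw [ENNReal.ofReal_rpow_of_nonneg (by positivity) (by positivity), ← Real.rpow_mul hX0.le]
    congr 2; field_simp
  rw [h3, ← ENNReal.mul_rpow_of_nonneg _ _ (by positivity),
    ← ENNReal.mul_rpow_of_nonneg _ _ (by positivity)]
  refine ENNReal.rpow_le_rpow ?_ (by positivity)
  refine (mul_le_mul_right (huv X hX) _).trans ?_
  rw [mul_left_comm]
  gcongr
  rw [← lintegral_const_mul' _ _ ENNReal.ofReal_ne_top, ← lintegral_indicator measurableSet_halfSpace]
  refine lintegral_mono fun Y => ?_
  by_cases hY : Y ∈ halfSpace n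
  swap
  · rw [Set.indicator_of_notMem hY]; exact bot_le
  have hY0 : 0 < height Y := hY
  rw [Set.indicator_of_mem hY, weightedKernel_of_pos hX0 hY0, hφ, Set.indicator_of_mem hY,
    ENNReal.mul_rpow_of_nonneg _ _ hx0.le, ← ENNReal.rpow_mul, one_div, inv_mul_cancel₀ hx0.ne',
    ENNReal.rpow_one, ENNReal.ofReal_rpow_of_nonneg (by positivity) hx0.le, ← Real.rpow_mul hY0.le,
    div_mul_cancel₀ _ hx0.ne', ← mul_assoc, ← mul_assoc, ← ENNReal.ofReal_mul (by positivity),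
    ← ENNReal.ofReal_mul (by positivity)]
  refine le_of_eq ?_
  congr 2
  have h4 : height Y ^ (-a) * height Y ^ a = 1 := by
    rw [← Real.rpow_add hY0]; simp
  rw [show r - (n + 1 : ℝ) = -(n + 1 - r) by ring]
  linear_combination -(height X ^ b * ‖X - Y‖ ^ (-(n + 1 - r : ℝ))) * h4

end Weighted

/-! ### First order: domination by the Riesz potential of the gradient. -/

section FirstOrder

variable {n : ℕ}

theorem enorm_gradient (f : HalfAmbient n → ℝ) (X : HalfAmbient n) :
    ‖∇ f X‖ₑ = ‖fderiv ℝ f X‖ₑ := by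
  rw [enorm_eq_iff_norm_eq, gradient, LinearIsometryEquiv.norm_map]

/-- Directions used to average the fundamental theorem of calculus along rays. -/
def upperShell (n : ℕ) : Set (HalfAmbient n) := {w | 1 / 2 < ‖w‖ ∧ ‖w‖ < 1 ∧ 0 < height w}

theorem isOpen_upperShell : IsOpen (upperShell n) :=
  (isOpen_lt continuous_const continuous_norm).inter
    ((isOpen_lt continuous_norm continuous_const).inter (isOpen_lt continuous_const continuous_height))

theorem volume_upperShell_ne_zero : volume (upperShell n) ≠ 0 := by
  refine (isOpen_upperShell.measure_pos volume ⟨(3 / 4 : ℝ) • eLast n, ?_⟩).ne'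
  simp only [upperShell, Set.mem_ofPred_eq, norm_smul, norm_eLast, height_smul, height_eLast]
  norm_num [abs_of_pos]

theorem volume_upperShell_ne_top : volume (upperShell n) ≠ ⊤ := by
  refine ne_top_of_le_ne_top (measure_ball_lt_top (x := (0 : HalfAmbient n)) (r := 1)).ne
    (measure_mono fun w hw => ?_)
  simpa using hw.2.1

/-- The fundamental theorem of calculus from `X` to infinity in the direction `w`. As `w` points
upwards, such a ray never leaves the half space, and no boundary term can arise. -/
theorem enorm_le_lintegral_ray {φ : HalfAmbient n → ℝ} (hφ : ContDiff ℝ 1 φ)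
    (hc : HasCompactSupport φ) (X : HalfAmbient n) {w : HalfAmbient n} (hw : w ∈ upperShell n) :
    ‖φ X‖ₑ ≤ ∫⁻ s in Set.Ioi (0 : ℝ), ‖fderiv ℝ φ (X + s • w)‖ₑ := by
  have hw0 : w ≠ 0 := by
    rintro rfl
    have := hw.1
    simp at this
    linarith
  -- The ray is traversed backwards because the one-variable bound integrates over `Iic 0`.
  set g : ℝ → ℝ := fun s => φ (X - s • w) with hg
  have hgC : ContDiff ℝ 1 g := hφ.comp (by fun_prop)
  have hemb : IsClosedEmbedding fun s : ℝ => X - s • w :=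
    (Homeomorph.subLeft X).isClosedEmbedding.comp (isClosedEmbedding_smul_left hw0)
  have hgc : HasCompactSupport g := hc.comp_isClosedEmbedding hemb
  have h1 := hgc.enorm_le_lintegral_Ici_deriv hgC 0
  have h2 : g 0 = φ X := by simp [hg]
  rw [h2] at h1
  refine h1.trans ?_
  rw [restrict_Ioi_eq_restrict_Ici, ← lintegral_indicator measurableSet_Iic,
    ← lintegral_indicator measurableSet_Ici, ← lintegral_neg_eq_self]
  refine lintegral_mono fun s => ?_
  by_cases hs : 0 ≤ s
  · rw [Set.indicator_of_mem (by simpa using hs), Set.indicator_of_mem (by exact hs)]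
    have hd : HasDerivAt g (fderiv ℝ φ (X + s • w) (-w)) (-s) := by
      have h3 : HasDerivAt (fun s : ℝ => X - s • w) (-w) (-s) := by
        simpa using ((hasDerivAt_id (-s)).smul_const w).const_sub X
      have h4 : HasFDerivAt φ (fderiv ℝ φ (X + s • w)) (X - (-s) • w) := by
        rw [neg_smul, sub_neg_eq_add]
        exact (hφ.differentiable one_ne_zero _).hasFDerivAt
      exact h4.comp_hasDerivAt (-s) h3
    rw [hd.deriv]
    rw [enorm_le_iff_norm_le]
    refine (ContinuousLinearMap.le_opNorm _ _).trans (mul_le_of_le_one_right (norm_nonneg _) ?_)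
    rw [norm_neg]; exact hw.2.1.le
  · rw [Set.indicator_of_notMem (by simpa using hs)]; exact bot_le

/-- Only `s` between `‖Z‖` and `2‖Z‖` contribute: an interval of length `‖Z‖` on which `s ^ (-(n+1))
≤ ‖Z‖ ^ (-(n+1))`. This is how averaging over rays produces the Riesz kernel of order one. -/
theorem lintegral_shell_scale_le (Z : HalfAmbient n) :
    ∫⁻ s in Set.Ioi (0 : ℝ), ENNReal.ofReal (s ^ (-(n + 1 : ℝ))) *
      (upperShell n).indicator 1 (s⁻¹ • Z) ≤
    (halfSpace n).indicator (fun Z => ENNReal.ofReal (‖Z‖ ^ (1 - (n + 1 : ℝ)))) Z := by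
  set ρ := ‖Z‖ with hρ
  have hρ0 : 0 ≤ ρ := norm_nonneg _
  have key : ∀ s ∈ Set.Ioi (0 : ℝ), ENNReal.ofReal (s ^ (-(n + 1 : ℝ))) *
      (upperShell n).indicator (1 : HalfAmbient n → ℝ≥0∞) (s⁻¹ • Z) ≤
      (Set.Ioo ρ (2 * ρ)).indicator (fun _ => (halfSpace n).indicator
        (fun _ => ENNReal.ofReal (ρ ^ (-(n + 1 : ℝ)))) Z) s := by
    intro s hs
    have hs : 0 < s := hs
    by_cases hmem : s⁻¹ • Z ∈ upperShell n
    · obtain ⟨h1, h2, h3⟩ := hmem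
      rw [norm_smul, Real.norm_of_nonneg (by positivity), ← hρ, inv_mul_eq_div] at h1 h2
      rw [lt_div_iff₀ hs] at h1
      rw [div_lt_one hs] at h2
      rw [height_smul] at h3
      have h3' : 0 < height Z := by
        by_contra hcon
        have := mul_nonpos_of_nonneg_of_nonpos (inv_nonneg.2 hs.le) (not_lt.1 hcon)
        linarith
      rw [Set.indicator_of_mem (s := Set.Ioo ρ (2 * ρ)) (by constructor <;> linarith),
        Set.indicator_of_mem (s := halfSpace n) (by exact h3')]
      refine (mul_le_mul_right (Set.indicator_le_self _ _ _) _).trans ?_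
      rw [Pi.one_apply, mul_one]
      refine ENNReal.ofReal_le_ofReal ?_
      exact Real.rpow_le_rpow_of_nonpos (by linarith) h2.le (by linarith)
    · rw [Set.indicator_of_notMem hmem, mul_zero]; exact bot_le
  refine (setLIntegral_mono' measurableSet_Ioi key).trans ?_
  refine (setLIntegral_le_lintegral _ _).trans ?_
  rw [lintegral_indicator measurableSet_Ioo, setLIntegral_const, Real.volume_Ioo]
  by_cases hZ : Z ∈ halfSpace n
  · rw [Set.indicator_of_mem hZ, Set.indicator_of_mem hZ, ← ENNReal.ofReal_mul (by positivity)]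
    refine ENNReal.ofReal_le_ofReal ?_
    have hZ0 : 0 < ρ := by
      have h1 : 0 < height Z := hZ
      linarith [le_abs_self (height Z), abs_height_le Z]
    rw [sub_eq_add_neg 1 (n + 1 : ℝ), Real.rpow_add hZ0, Real.rpow_one]
    exact le_of_eq (by ring)
  · rw [Set.indicator_of_notMem hZ, Set.indicator_of_notMem hZ, zero_mul]

/-- A compactly supported function is dominated on the half space by the Riesz potential of order
one of its gradient over the half space. -/
theorem exists_enorm_le_riesz_one (n : ℕ) : ∃ c : ℝ≥0∞, c ≠ ⊤ ∧ ∀ φ : HalfAmbient n → ℝ,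
    ContDiff ℝ 1 φ → HasCompactSupport φ → ∀ X ∈ halfSpace n, ‖φ X‖ₑ ≤
      c * ∫⁻ Y in halfSpace n, ENNReal.ofReal (‖X - Y‖ ^ (1 - (n + 1 : ℝ))) * ‖∇ φ Y‖ₑ := by
  refine ⟨(volume (upperShell n))⁻¹, ENNReal.inv_ne_top.2 volume_upperShell_ne_zero,
    fun φ hφ hc X hX => ?_⟩
  rw [mul_comm, ← div_eq_mul_inv,
    ENNReal.le_div_iff_mul_le (Or.inl volume_upperShell_ne_zero) (Or.inl volume_upperShell_ne_top)]
  simp_rw [enorm_gradient]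
  set D : HalfAmbient n → ℝ≥0∞ := fun Y => ‖fderiv ℝ φ Y‖ₑ with hD
  have hDc : Continuous D := (hφ.continuous_fderiv one_ne_zero).enorm
  have mD : Measurable D := hDc.measurable
  set A := upperShell n with hA
  have mA : MeasurableSet A := isOpen_upperShell.measurableSet
  have mI : Measurable (A.indicator (1 : HalfAmbient n → ℝ≥0∞)) :=
    Measurable.indicator measurable_const mA
  -- The ray bound is averaged over directions `w`, the substitution `Z = s • w` is made, and the
  -- `s`-integral is carried out first.
  calc ‖φ X‖ₑ * volume A = ∫⁻ _ in A, ‖φ X‖ₑ := (setLIntegral_const _ _).symm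
    _ ≤ ∫⁻ w in A, ∫⁻ s in Set.Ioi (0 : ℝ), D (X + s • w) :=
        setLIntegral_mono' mA fun w hw => enorm_le_lintegral_ray hφ hc X hw
    _ = ∫⁻ s in Set.Ioi (0 : ℝ), ∫⁻ w in A, D (X + s • w) := by
        rw [lintegral_lintegral_swap]
        exact Measurable.aemeasurable (by fun_prop)
    _ = ∫⁻ s in Set.Ioi (0 : ℝ), ∫⁻ Z, ENNReal.ofReal (s ^ (-(n + 1 : ℝ))) *
          A.indicator 1 (s⁻¹ • Z) * D (X + Z) := by
        refine setLIntegral_congr_fun measurableSet_Ioi fun s hs => ?_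
        have hs : 0 < s := hs
        rw [lintegral_eq_lintegral_comp_smul volume hs, finrank_halfAmbient,
          ← lintegral_const_mul' _ _ ENNReal.ofReal_ne_top, ← lintegral_indicator mA]
        refine lintegral_congr fun w => ?_
        rw [inv_smul_smul₀ hs.ne', ← mul_assoc, ← mul_assoc, ENNReal.ofReal_rpow_mul_rpow hs]
        by_cases hw : w ∈ A <;> simp [hw]
    _ = ∫⁻ Z, ∫⁻ s in Set.Ioi (0 : ℝ), ENNReal.ofReal (s ^ (-(n + 1 : ℝ))) *
          A.indicator 1 (s⁻¹ • Z) * D (X + Z) := by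
        rw [lintegral_lintegral_swap]
        refine Measurable.aemeasurable ?_
        have : Measurable fun z : ℝ × HalfAmbient n =>
            A.indicator (1 : HalfAmbient n → ℝ≥0∞) (z.1⁻¹ • z.2) := mI.comp (by fun_prop)
        exact ((by fun_prop : Measurable fun z : ℝ × HalfAmbient n =>
          ENNReal.ofReal (z.1 ^ (-(n + 1 : ℝ)))).mul this).mul (by fun_prop)
    _ ≤ ∫⁻ Z, (halfSpace n).indicator (fun Z => ENNReal.ofReal (‖Z‖ ^ (1 - (n + 1 : ℝ)))) Z *
          D (X + Z) := by
        refine lintegral_mono fun Z => ?_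
        have : Measurable fun s : ℝ => A.indicator (1 : HalfAmbient n → ℝ≥0∞) (s⁻¹ • Z) :=
          mI.comp (by fun_prop)
        rw [lintegral_mul_const _ (by fun_prop)]
        exact mul_le_mul_left (lintegral_shell_scale_le Z) _
    _ = ∫⁻ Y, (halfSpace n).indicator (fun Z => ENNReal.ofReal (‖Z‖ ^ (1 - (n + 1 : ℝ)))) (Y - X) *
          D Y := by
        rw [← lintegral_sub_right_eq_self _ X]
        simp
    _ ≤ ∫⁻ Y in halfSpace n, ENNReal.ofReal (‖X - Y‖ ^ (1 - (n + 1 : ℝ))) * D Y := by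
        rw [← lintegral_indicator measurableSet_halfSpace]
        refine lintegral_mono fun Y => ?_
        by_cases hY : Y - X ∈ halfSpace n
        · have hY' : Y ∈ halfSpace n := by
            have h1 : 0 < height X := hX
            have h2 : 0 < height Y - height X := hY
            change 0 < height Y
            linarith
          rw [Set.indicator_of_mem hY, Set.indicator_of_mem hY', norm_sub_rev]
        · rw [Set.indicator_of_notMem hY, zero_mul]; exact bot_le

end FirstOrder

/-! ### Even and odd reflection across the boundary. -/

section Folding

/-- The even extension of a differentiable function with vanishing derivative at `0`. -/
theorem HasDerivAt.comp_abs_of_deriv_zero {h h' : ℝ → ℝ} (hd : ∀ s, HasDerivAt h (h' s) s)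
    (h0 : h' 0 = 0) (s : ℝ) :
    HasDerivAt (fun s => h |s|) ((SignType.sign s : ℝ) * h' |s|) s := by
  rcases eq_or_ne s 0 with rfl | hs
  · have h1 := (hd 0).isLittleO
    rw [h0] at h1
    have h2 : Tendsto (fun s : ℝ => |s|) (𝓝 0) (𝓝 0) := by simpa using (continuous_abs.tendsto (0 : ℝ))
    have h3 := h1.comp_tendsto h2
    rw [hasDerivAt_iff_isLittleO]
    refine (h3.trans_isBigO (Asymptotics.IsBigO.of_bound 1 ?_)).congr_left ?_
    · simp
    · intro s; simp [h0]
  · rw [mul_comm]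
    exact (hd |s|).comp s (hasDerivAt_abs hs)

/-- The odd extension of a differentiable function vanishing at `0`. -/
theorem HasDerivAt.sign_mul_comp_abs {h h' : ℝ → ℝ} (hd : ∀ s, HasDerivAt h (h' s) s)
    (h0 : h 0 = 0) (s : ℝ) :
    HasDerivAt (fun s => (SignType.sign s : ℝ) * h |s|) (h' |s|) s := by
  rcases eq_or_ne s 0 with rfl | hs
  · have h1 := (hd 0).isLittleO
    rw [h0] at h1
    have h2 : Tendsto (fun s : ℝ => |s|) (𝓝 0) (𝓝 0) := by simpa using (continuous_abs.tendsto (0 : ℝ))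
    have h3 := h1.comp_tendsto h2
    rw [hasDerivAt_iff_isLittleO]
    refine Asymptotics.IsBigO.trans_isLittleO (Asymptotics.IsBigO.of_bound 1 ?_)
      (h3.trans_isBigO (Asymptotics.IsBigO.of_bound 1 (g := fun s : ℝ => s - 0) ?_))
    · refine Eventually.of_forall fun s => ?_
      have e : (SignType.sign s : ℝ) * h |s| - (SignType.sign (0 : ℝ) : ℝ) * h |0| - (s - 0) • h' |0| =
          (SignType.sign s : ℝ) * (h |s| - 0 - (|s| - 0) • h' 0) := by
        have : (SignType.sign s : ℝ) * |s| = s := sign_mul_abs s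
        simp only [sub_zero, smul_eq_mul, abs_zero, h0, mul_zero]
        linear_combination h' 0 * this
      rw [e, norm_mul, one_mul]
      refine mul_le_of_le_one_left (norm_nonneg _) ?_
      rcases lt_trichotomy s 0 with h | h | h <;> simp [h]
    · simp
  · have h1 : HasDerivAt (fun s => h |s|) (h' |s| * (SignType.sign s : ℝ)) s :=
      (hd |s|).comp s (hasDerivAt_abs hs)
    have h2 := h1.const_mul (SignType.sign s : ℝ)
    have h3 : (SignType.sign s : ℝ) * (h' |s| * (SignType.sign s : ℝ)) = h' |s| := by
      rcases lt_or_gt_of_ne hs with h | h <;> simp [h]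
    rw [h3] at h2
    refine h2.congr_of_eventuallyEq ?_
    rcases lt_or_gt_of_ne hs with h | h
    · filter_upwards [eventually_lt_nhds h] with r hr
      simp [h, hr]
    · filter_upwards [eventually_gt_nhds h] with r hr
      simp [h, hr]

variable {n : ℕ}

/-- The folding map `(x, t) ↦ (x, |t|)`. -/
noncomputable def fold (X : HalfAmbient n) : HalfAmbient n := bdryProj X + |height X| • eLast n

@[fun_prop]
theorem continuous_fold : Continuous (fold : HalfAmbient n → HalfAmbient n) := by
  have := continuous_height (n := n)
  unfold fold; fun_prop

theorem bdryProj_add_height_smul (X : HalfAmbient n) : bdryProj X + height X • eLast n = X := by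
  simp [bdryProj]

theorem fold_of_nonneg {X : HalfAmbient n} (hX : 0 ≤ height X) : fold X = X := by
  rw [fold, abs_of_nonneg hX, bdryProj_add_height_smul]

theorem fold_apply (X : HalfAmbient n) (i : Fin (n + 1)) :
    fold X i = if i = Fin.last n then |X i| else X i := by
  by_cases h : i = Fin.last n
  · subst h; simp [fold, bdryProj, eLast, height]
  · simp [fold, bdryProj, eLast, height, h]

theorem norm_fold (X : HalfAmbient n) : ‖fold X‖ = ‖X‖ := by
  rw [← sq_eq_sq₀ (norm_nonneg _) (norm_nonneg _), EuclideanSpace.norm_sq_eq,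
    EuclideanSpace.norm_sq_eq]
  refine Finset.sum_congr rfl fun i _ => ?_
  rw [fold_apply]
  split_ifs <;> simp

/-- Needed because Green's identity is used on the whole space: a radially decreasing kernel centred
in the upper half space only grows when its argument is folded. -/
theorem norm_fold_sub_le {X : HalfAmbient n} (hX : 0 ≤ height X) (Y : HalfAmbient n) :
    ‖fold Y - X‖ ≤ ‖Y - X‖ := by
  rw [← sq_le_sq₀ (norm_nonneg _) (norm_nonneg _), EuclideanSpace.norm_sq_eq,
    EuclideanSpace.norm_sq_eq]
  refine Finset.sum_le_sum fun i _ => ?_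
  rw [PiLp.sub_apply, PiLp.sub_apply, fold_apply]
  split_ifs with h
  · subst h
    have h0 : 0 ≤ X (Fin.last n) := hX
    rw [sq_le_sq, Real.norm_eq_abs, Real.norm_eq_abs, abs_abs, abs_abs]
    nth_rw 1 [← abs_of_nonneg h0]
    exact abs_abs_sub_abs_le_abs_sub _ _
  · exact le_rfl

theorem hasCompactSupport_comp_fold {F : HalfAmbient n → ℝ} (hF : HasCompactSupport F) :
    HasCompactSupport (F ∘ fold) := by
  obtain ⟨R, hR⟩ := hF.isCompact.isBounded.subset_closedBall 0
  refine HasCompactSupport.intro (isCompact_closedBall (0 : HalfAmbient n) R) fun X hX => ?_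
  have : fold X ∉ tsupport F := fun h => hX (by
    have := hR h
    rwa [mem_closedBall_zero_iff, norm_fold, ← mem_closedBall_zero_iff] at this)
  exact image_eq_zero_of_notMem_tsupport (f := F) this

/-- The reflection `(x, t) ↦ (x, -t)`. -/
noncomputable def reflectHeight (n : ℕ) : HalfAmbient n ≃ₗᵢ[ℝ] HalfAmbient n :=
  LinearIsometryEquiv.piLpCongrRight 2 fun i : Fin (n + 1) =>
    if i = Fin.last n then LinearIsometryEquiv.neg ℝ else LinearIsometryEquiv.refl ℝ ℝ

theorem reflectHeight_apply (X : HalfAmbient n) (i : Fin (n + 1)) :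
    reflectHeight n X i = if i = Fin.last n then -X i else X i := by
  by_cases h : i = Fin.last n <;> simp [reflectHeight, h]

theorem fold_reflectHeight (X : HalfAmbient n) : fold (reflectHeight n X) = fold X := by
  ext i
  rw [fold_apply, fold_apply, reflectHeight_apply]
  split_ifs <;> simp

theorem volume_height_eq_zero : volume {X : HalfAmbient n | height X = 0} = 0 := by
  have h := Measure.addHaar_submodule (volume : Measure (HalfAmbient n))
    (LinearMap.ker (EuclideanSpace.proj (𝕜 := ℝ) (Fin.last n)).toLinearMap) (fun h => by
      have : eLast n ∈ (⊤ : Submodule ℝ (HalfAmbient n)) := trivial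
      rw [← h] at this
      simp [eLast] at this)
  convert h using 2
  ext X
  simp [height]

/-- Folding is the identity above the boundary and an isometry onto the upper half below it, and the
boundary is a null set. -/
theorem lintegral_comp_fold_le (H : HalfAmbient n → ℝ≥0∞) :
    ∫⁻ Y, H (fold Y) ≤ 2 * ∫⁻ Y in halfSpace n, H Y := by
  have hcover : (Set.univ : Set (HalfAmbient n)) ⊆
      (halfSpace n ∪ (reflectHeight n) ⁻¹' (halfSpace n)) ∪ {X | height X = 0} := by
    intro X _
    rcases lt_trichotomy (height X) 0 with h | h | h
    · refine Or.inl (Or.inr ?_)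
      change 0 < reflectHeight n X (Fin.last n)
      rw [reflectHeight_apply]
      rw [if_pos rfl]
      exact neg_pos.2 h
    · exact Or.inr h
    · exact Or.inl (Or.inl h)
  have h1 : ∫⁻ Y in halfSpace n, H (fold Y) = ∫⁻ Y in halfSpace n, H Y :=
    setLIntegral_congr_fun measurableSet_halfSpace fun Y hY => by
      rw [fold_of_nonneg (le_of_lt hY)]
  have h2 : ∫⁻ Y in (reflectHeight n) ⁻¹' (halfSpace n), H (fold Y) =
      ∫⁻ Y in halfSpace n, H Y := by
    have := (reflectHeight n).measurePreserving.setLIntegral_comp_preimage_emb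
      (reflectHeight n).toHomeomorph.measurableEmbedding (fun Y => H (fold Y)) (halfSpace n)
    simp only [fold_reflectHeight] at this
    rw [this, h1]
  have h3 : ∫⁻ Y in {X : HalfAmbient n | height X = 0}, H (fold Y) = 0 :=
    setLIntegral_measure_zero _ _ volume_height_eq_zero
  rw [← setLIntegral_univ]
  refine (lintegral_mono_set hcover).trans ((lintegral_union_le _ _ _).trans ?_)
  rw [h3, add_zero]
  refine (lintegral_union_le _ _ _).trans ?_
  rw [h1, h2, two_mul]

/-- The coordinate directions. -/
noncomputable def coordVec (i : Fin (n + 1)) : HalfAmbient n := EuclideanSpace.single i 1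

/-- The sign produced by differentiating along the `i`-th coordinate through the folding map. -/
noncomputable def foldSign (i : Fin (n + 1)) (X : HalfAmbient n) : ℝ :=
  if i = Fin.last n then (SignType.sign (height X) : ℝ) else 1

theorem coordVec_last : coordVec (Fin.last n) = eLast n := rfl

theorem abs_foldSign_le (i : Fin (n + 1)) (X : HalfAmbient n) : |foldSign i X| ≤ 1 := by
  unfold foldSign
  split_ifs
  · rcases lt_trichotomy (height X) 0 with h | h | h <;> simp [h]
  · simp

theorem measurable_foldSign (i : Fin (n + 1)) :
    Measurable (foldSign i : HalfAmbient n → ℝ) := by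
  unfold foldSign
  split_ifs
  · have h1 : Measurable fun t : ℝ => (SignType.sign t : ℝ) := by
      have : (fun t : ℝ => (SignType.sign t : ℝ)) = fun t =>
          (Set.Ioi (0 : ℝ)).indicator 1 t - (Set.Iio (0 : ℝ)).indicator 1 t := by
        ext t
        rcases lt_trichotomy t 0 with h | h | h <;>
          simp [h, not_lt.2 h.le]
      rw [this]
      exact (measurable_one.indicator measurableSet_Ioi).sub
        (measurable_one.indicator measurableSet_Iio)
    exact h1.comp measurable_height
  · exact measurable_const

theorem fold_add_smul_coordVec {i : Fin (n + 1)} (hi : i ≠ Fin.last n) (X : HalfAmbient n) (s : ℝ) :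
    fold (X + s • coordVec i) = fold X + s • coordVec i := by
  ext j
  rw [fold_apply, PiLp.add_apply, PiLp.add_apply, fold_apply]
  split_ifs with hj
  · subst hj; simp [coordVec, hi.symm]
  · rfl

theorem fold_add_smul_eLast (X : HalfAmbient n) (s : ℝ) :
    fold (X + s • eLast n) = bdryProj X + |height X + s| • eLast n := by
  have : bdryProj (X + s • eLast n) = bdryProj X := by
    simp [bdryProj, add_smul]
  rw [fold, this]; simp

theorem hasDerivAt_along {f : HalfAmbient n → ℝ} (hf : Differentiable ℝ f) (Z v : HalfAmbient n)
    (s : ℝ) : HasDerivAt (fun s : ℝ => f (Z + s • v)) (fderiv ℝ f (Z + s • v) v) s := by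
  have h : HasDerivAt (fun s : ℝ => Z + s • v) v s := by
    simpa using ((hasDerivAt_id s).smul_const v).const_add Z
  exact (hf _).hasFDerivAt.comp_hasDerivAt s h

/-- Across the boundary this is where the vanishing normal derivative enters: it removes the corner
of the even extension. -/
theorem hasLineDerivAt_comp_fold {f : HalfAmbient n → ℝ} (hf : Differentiable ℝ f)
    (hb : ∀ X, height X = 0 → fderiv ℝ f X (eLast n) = 0) (i : Fin (n + 1)) (X : HalfAmbient n) :
    HasLineDerivAt ℝ (fun X => f (fold X)) (foldSign i X * fderiv ℝ f (fold X) (coordVec i)) X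
      (coordVec i) := by
  unfold HasLineDerivAt foldSign
  split_ifs with hi
  · subst hi
    simp_rw [coordVec_last, fold_add_smul_eLast]
    have h1 := HasDerivAt.comp_abs_of_deriv_zero (hasDerivAt_along hf (bdryProj X) (eLast n))
      (by simp [hb]) (height X + 0)
    have h2 := HasDerivAt.comp_const_add (height X) 0 h1
    simpa [fold] using h2
  · simp_rw [fold_add_smul_coordVec hi, one_mul]
    simpa using hasDerivAt_along hf (fold X) (coordVec i) 0

/-- Meant for `f = ∂ᵢφ`. In the normal direction the extension is odd, and it is differentiable
because `∂ₜφ` vanishes on the boundary; hence second derivatives of the even extension carry no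
boundary contribution. -/
theorem hasLineDerivAt_foldSign_mul_comp_fold {f : HalfAmbient n → ℝ} (hf : Differentiable ℝ f)
    (i : Fin (n + 1)) (hb : i = Fin.last n → ∀ X, height X = 0 → f X = 0) (X : HalfAmbient n) :
    HasLineDerivAt ℝ (fun X => foldSign i X * f (fold X)) (fderiv ℝ f (fold X) (coordVec i)) X
      (coordVec i) := by
  unfold HasLineDerivAt foldSign
  split_ifs with hi
  · subst hi
    simp_rw [coordVec_last, fold_add_smul_eLast]
    have h1 := HasDerivAt.sign_mul_comp_abs (hasDerivAt_along hf (bdryProj X) (eLast n))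
      (by simp [hb]) (height X + 0)
    have h2 := HasDerivAt.comp_const_add (height X) 0 h1
    simpa [fold] using h2
  · simp_rw [fold_add_smul_coordVec hi, one_mul]
    simpa using hasDerivAt_along hf (fold X) (coordVec i) 0

end Folding

/-! ### Second order: Green's identity and the Riesz potential of the Laplacian. -/

section SecondOrder

variable {n : ℕ}

theorem hasLineDerivAt_norm_sq_add (X Y : HalfAmbient n) (c : ℝ) (i : Fin (n + 1)) :
    HasLineDerivAt ℝ (fun Y => ‖Y - X‖ ^ 2 + c) (2 * (Y - X) i) Y (coordVec i) := by
  unfold HasLineDerivAt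
  have h : ∀ s : ℝ, ‖Y + s • coordVec i - X‖ ^ 2 + c =
      ‖Y - X‖ ^ 2 + s * (2 * (Y - X) i) + s ^ 2 + c := by
    intro s
    rw [show Y + s • coordVec i - X = (Y - X) + s • coordVec i by abel, norm_add_sq_real,
      inner_smul_right, norm_smul, coordVec, EuclideanSpace.inner_single_right]
    simp
    ring
  simp_rw [h]
  have h1 := ((((hasDerivAt_id (0 : ℝ)).mul_const (2 * (Y - X) i)).const_add (‖Y - X‖ ^ 2)).add
    ((hasDerivAt_id (0 : ℝ)).pow 2)).add_const c
  simpa using h1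

theorem hasLineDerivAt_norm_sq_add_rpow (X Y : HalfAmbient n) {c : ℝ} (hc : 0 < c) (e : ℝ)
    (i : Fin (n + 1)) :
    HasLineDerivAt ℝ (fun Y => (‖Y - X‖ ^ 2 + c) ^ e)
      (2 * e * (Y - X) i * (‖Y - X‖ ^ 2 + c) ^ (e - 1)) Y (coordVec i) := by
  have h := HasDerivAt.rpow_const (p := e) (hasLineDerivAt_norm_sq_add X Y c i)
    (Or.inl (by positivity))
  unfold HasLineDerivAt
  refine h.congr_deriv ?_
  simp only [zero_smul, add_zero]
  ring

theorem hasLineDerivAt_coord_mul_norm_sq_add_rpow (X Y : HalfAmbient n) {c : ℝ} (hc : 0 < c) (e : ℝ)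
    (i : Fin (n + 1)) :
    HasLineDerivAt ℝ (fun Y => 2 * e * (Y - X) i * (‖Y - X‖ ^ 2 + c) ^ (e - 1))
      (2 * e * (‖Y - X‖ ^ 2 + c) ^ (e - 1) +
        4 * e * (e - 1) * (Y - X) i ^ 2 * (‖Y - X‖ ^ 2 + c) ^ (e - 2)) Y (coordVec i) := by
  have h := hasLineDerivAt_norm_sq_add_rpow X Y hc (e - 1) i
  unfold HasLineDerivAt at h ⊢
  have h1 : HasDerivAt (fun s : ℝ => 2 * e * (Y + s • coordVec i - X) i) (2 * e) 0 := by
    have : ∀ s : ℝ, 2 * e * (Y + s • coordVec i - X) i = 2 * e * (Y - X) i + s * (2 * e) := by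
      intro s; simp [coordVec]; ring
    simp_rw [this]
    simpa using ((hasDerivAt_id (0 : ℝ)).mul_const (2 * e)).const_add (2 * e * (Y - X) i)
  have h2 := h1.mul h
  refine h2.congr_deriv ?_
  simp only [zero_smul, add_zero]
  rw [show e - 1 - 1 = e - 2 by ring]
  ring

theorem continuous_norm_sq_add_rpow (X : HalfAmbient n) {c : ℝ} (hc : 0 < c) (e : ℝ) :
    Continuous fun Y : HalfAmbient n => (‖Y - X‖ ^ 2 + c) ^ e :=
  Continuous.rpow_const (by fun_prop) fun Y => Or.inl (by positivity)

theorem integrable_comp_fold_mul {f g : HalfAmbient n → ℝ} (hf : Continuous f)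
    (hfc : HasCompactSupport f) (hg : Continuous g) : Integrable fun Y => f (fold Y) * g Y :=
  Continuous.integrable_of_hasCompactSupport (by fun_prop)
    ((hasCompactSupport_comp_fold hfc).mul_right (f' := g))

theorem integrable_foldSign_mul_comp_fold_mul (i : Fin (n + 1)) {f g : HalfAmbient n → ℝ}
    (hf : Continuous f) (hfc : HasCompactSupport f) (hg : Continuous g) :
    Integrable fun Y => foldSign i Y * f (fold Y) * g Y := by
  simp_rw [mul_assoc]
  exact (integrable_comp_fold_mul hf hfc hg).bdd_mul (c := 1)
    (measurable_foldSign i).aestronglyMeasurable (Eventually.of_forall (abs_foldSign_le i))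

theorem laplacian_eq_sum_coord {φ : HalfAmbient n → ℝ} (hφ : ContDiff ℝ ∞ φ) (Y : HalfAmbient n) :
    (Δ φ) Y = ∑ i, fderiv ℝ (fun Z => fderiv ℝ φ Z (coordVec i)) Y (coordVec i) := by
  have hd : Differentiable ℝ (fderiv ℝ φ) :=
    (hφ.fderiv_right (m := ∞) (by simp)).differentiable (by simp)
  rw [InnerProductSpace.laplacian_eq_iteratedFDeriv_orthonormalBasis φ
    (EuclideanSpace.basisFun (Fin (n + 1)) ℝ)]
  refine Finset.sum_congr rfl fun i _ => ?_
  rw [iteratedFDeriv_two_apply, fderiv_clm_apply (hd Y) (differentiableAt_const _)]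
  simp [coordVec]

/-- The left side is the Laplacian of `(‖Y - X‖² + c) ^ e` with `e = -(n-1)/2`. This exponent
satisfies `2e(n+1) + 4e(e-1) = 0`, so the terms in `‖Y - X‖²` cancel and only a multiple of `c`
remains. -/
theorem sum_coord_norm_sq_add_rpow (X Y : HalfAmbient n) {c : ℝ} (hc : 0 < c) :
    ∑ i : Fin (n + 1), (2 * (-((n - 1 : ℝ) / 2)) * (‖Y - X‖ ^ 2 + c) ^ (-((n - 1 : ℝ) / 2) - 1) +
      4 * (-((n - 1 : ℝ) / 2)) * (-((n - 1 : ℝ) / 2) - 1) * (Y - X) i ^ 2 *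
        (‖Y - X‖ ^ 2 + c) ^ (-((n - 1 : ℝ) / 2) - 2)) =
      -((n - 1) * (n + 1) * c * (‖Y - X‖ ^ 2 + c) ^ (-((n - 1 : ℝ) / 2) - 2)) := by
  have h1 : ∑ i : Fin (n + 1), (Y - X) i ^ 2 = ‖Y - X‖ ^ 2 := by
    rw [EuclideanSpace.norm_sq_eq]; simp
  have hp : 0 < ‖Y - X‖ ^ 2 + c := by positivity
  have h2 : (‖Y - X‖ ^ 2 + c) ^ (-((n - 1 : ℝ) / 2) - 1) =
      (‖Y - X‖ ^ 2 + c) ^ (-((n - 1 : ℝ) / 2) - 2) * (‖Y - X‖ ^ 2 + c) := by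
    nth_rw 3 [← Real.rpow_one (‖Y - X‖ ^ 2 + c)]
    rw [← Real.rpow_add hp]; congr 1; ring
  rw [Finset.sum_add_distrib, Finset.sum_const, ← Finset.sum_mul, ← Finset.mul_sum, h1, h2]
  simp
  ring

/-- Green's identity on the half space for a function with vanishing normal derivative, against the
regularized fundamental solution of the Laplacian. -/
theorem integral_comp_fold_mul_regularized {φ : HalfAmbient n → ℝ} (hφ : ContDiff ℝ ∞ φ)
    (hc : HasCompactSupport φ) (hb : ∀ X, height X = 0 → fderiv ℝ φ X (eLast n) = 0)
    (X : HalfAmbient n) {c : ℝ} (hc0 : 0 < c) :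
    ∫ Y, φ (fold Y) *
        ((n - 1) * (n + 1) * c * (‖Y - X‖ ^ 2 + c) ^ (-((n - 1 : ℝ) / 2) - 2)) =
      -∫ Y, (Δ φ) (fold Y) * (‖Y - X‖ ^ 2 + c) ^ (-((n - 1 : ℝ) / 2)) := by
  set e : ℝ := -((n - 1 : ℝ) / 2) with he
  set pd : Fin (n + 1) → HalfAmbient n → ℝ := fun i Z => fderiv ℝ φ Z (coordVec i) with hpd
  set pd2 : Fin (n + 1) → HalfAmbient n → ℝ := fun i Z => fderiv ℝ (pd i) Z (coordVec i) with hpd2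
  have cpd : ∀ i, ContDiff ℝ ∞ (pd i) := fun i =>
    (hφ.fderiv_right (m := ∞) (by simp)).clm_apply contDiff_const
  have cpd2 : ∀ i, Continuous (pd2 i) := fun i =>
    (((cpd i).fderiv_right (m := ∞) (by simp)).clm_apply contDiff_const).continuous
  have spd : ∀ i, HasCompactSupport (pd i) := fun i => hc.fderiv_apply ℝ _
  have spd2 : ∀ i, HasCompactSupport (pd2 i) := fun i => (spd i).fderiv_apply ℝ _
  set G : HalfAmbient n → ℝ := fun Y => (‖Y - X‖ ^ 2 + c) ^ e with hG
  set G1 : Fin (n + 1) → HalfAmbient n → ℝ := fun i Y =>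
    2 * e * (Y - X) i * (‖Y - X‖ ^ 2 + c) ^ (e - 1) with hG1
  set G2 : Fin (n + 1) → HalfAmbient n → ℝ := fun i Y =>
    2 * e * (‖Y - X‖ ^ 2 + c) ^ (e - 1) +
        4 * e * (e - 1) * (Y - X) i ^ 2 * (‖Y - X‖ ^ 2 + c) ^ (e - 2) with hG2
  have k0 := continuous_norm_sq_add_rpow X hc0 e
  have k1 := continuous_norm_sq_add_rpow X hc0 (e - 1)
  have k2 := continuous_norm_sq_add_rpow X hc0 (e - 2)
  have cG1 : ∀ i, Continuous (G1 i) := fun i => by simp only [hG1]; fun_prop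
  have cG2 : ∀ i, Continuous (G2 i) := fun i => by simp only [hG2]; fun_prop
  -- Two integrations by parts on the whole space: the first differentiates the even extension of
  -- `φ`, the second the signed extension of `∂ᵢφ`.
  have step : ∀ i, ∫ Y, φ (fold Y) * G2 i Y = ∫ Y, pd2 i (fold Y) * G Y := by
    intro i
    have s1 := integral_bilinear_hasLineDerivAt_right_eq_neg_left_of_integrable
      (μ := (volume : Measure (HalfAmbient n))) (B := ContinuousLinearMap.mul ℝ ℝ)
      (f := fun Y => φ (fold Y)) (f' := fun Y => foldSign i Y * pd i (fold Y))
      (g := G1 i) (g' := G2 i) (v := coordVec i)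
      (integrable_foldSign_mul_comp_fold_mul i (cpd i).continuous (spd i) (cG1 i))
      (integrable_comp_fold_mul hφ.continuous hc (cG2 i))
      (integrable_comp_fold_mul hφ.continuous hc (cG1 i))
      (fun Y _ => hasLineDerivAt_comp_fold (hφ.differentiable (by simp)) hb i Y)
      (fun Y _ => hasLineDerivAt_coord_mul_norm_sq_add_rpow X Y hc0 e i)
    have s2 := integral_bilinear_hasLineDerivAt_right_eq_neg_left_of_integrable
      (μ := (volume : Measure (HalfAmbient n))) (B := ContinuousLinearMap.mul ℝ ℝ)
      (f := fun Y => foldSign i Y * pd i (fold Y)) (f' := fun Y => pd2 i (fold Y))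
      (g := G) (g' := G1 i) (v := coordVec i)
      (integrable_comp_fold_mul (cpd2 i) (spd2 i) k0)
      (integrable_foldSign_mul_comp_fold_mul i (cpd i).continuous (spd i) (cG1 i))
      (integrable_foldSign_mul_comp_fold_mul i (cpd i).continuous (spd i) k0)
      (fun Y _ => hasLineDerivAt_foldSign_mul_comp_fold ((cpd i).differentiable (by simp)) i
        (fun hi Z hZ => by subst hi; exact hb Z hZ) Y)
      (fun Y _ => hasLineDerivAt_norm_sq_add_rpow X Y hc0 e i)
    simp only [ContinuousLinearMap.mul_apply'] at s1 s2
    rw [s1, s2, neg_neg]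
  have hlap : ∀ Y, (Δ φ) (fold Y) * (‖Y - X‖ ^ 2 + c) ^ e = ∑ i, pd2 i (fold Y) * G Y := fun Y => by
    rw [laplacian_eq_sum_coord hφ, Finset.sum_mul]
  have hsum : ∀ Y, φ (fold Y) * ((n - 1) * (n + 1) * c * (‖Y - X‖ ^ 2 + c) ^ (e - 2)) =
      -∑ i, φ (fold Y) * G2 i Y := fun Y => by
    rw [← Finset.mul_sum, he, sum_coord_norm_sq_add_rpow X Y hc0]; ring
  simp_rw [hlap, hsum]
  rw [integral_neg, integral_finsetSum _ fun i _ => integrable_comp_fold_mul hφ.continuous hc (cG2 i),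
    integral_finsetSum _ fun i _ => integrable_comp_fold_mul (cpd2 i) (spd2 i) k0]
  simp_rw [step, hG]

/-- The substitution `Y = X + ε • Z`: with `c = ε²` all powers of `ε` cancel, so the kernel is an
approximate identity of fixed mass. -/
theorem integral_comp_fold_mul_regularized_eq (φ : HalfAmbient n → ℝ) (X : HalfAmbient n) {ε : ℝ}
    (hε : 0 < ε) :
    ∫ Y, φ (fold Y) *
        ((n - 1) * (n + 1) * ε ^ 2 * (‖Y - X‖ ^ 2 + ε ^ 2) ^ (-((n - 1 : ℝ) / 2) - 2)) =
      ∫ Z, φ (fold (X + ε • Z)) * ((n - 1) * (n + 1) * (1 + ‖Z‖ ^ 2) ^ (-(n + 3 : ℝ) / 2)) := by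
  have h := Measure.integral_comp_smul (volume : Measure (HalfAmbient n)) (fun W => φ (fold (X + W)) *
        ((n - 1) * (n + 1) * ε ^ 2 * (‖W‖ ^ 2 + ε ^ 2) ^ (-((n - 1 : ℝ) / 2) - 2))) ε
  rw [← integral_add_left_eq_self _ X]
  simp only [add_sub_cancel_left]
  have hN : Module.finrank ℝ (HalfAmbient n) = n + 1 := by simp
  have hpos : 0 < ε ^ (n + 1) := by positivity
  rw [hN, abs_of_pos (by positivity), smul_eq_mul, inv_mul_eq_div, eq_div_iff hpos.ne'] at h
  rw [← h, ← integral_mul_const]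
  refine integral_congr_ae (Eventually.of_forall fun Z => ?_)
  simp only
  have h1 : ‖ε • Z‖ ^ 2 + ε ^ 2 = ε ^ 2 * (1 + ‖Z‖ ^ 2) := by
    rw [norm_smul, Real.norm_of_nonneg hε.le]; ring
  have h2 : (ε ^ 2) ^ (-((n - 1 : ℝ) / 2) - 2) * (ε ^ 2 * ε ^ (n + 1)) = 1 := by
    rw [← Real.rpow_natCast ε 2, ← Real.rpow_mul hε.le, ← Real.rpow_natCast ε (n + 1),
      ← Real.rpow_add hε, ← Real.rpow_add hε]
    convert Real.rpow_zero ε using 2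
    push_cast
    ring
  rw [h1, Real.mul_rpow (by positivity) (by positivity),
    show -((n - 1 : ℝ) / 2) - 2 = -(n + 3 : ℝ) / 2 by ring] at *
  linear_combination (φ (fold (X + ε • Z)) * ((n - 1) * (n + 1)) *
    (1 + ‖Z‖ ^ 2) ^ (-(n + 3 : ℝ) / 2)) * h2

/-- A compactly supported function with vanishing normal derivative at the boundary is dominated on
the half space by the Riesz potential of order two of its Laplacian over the half space. -/
theorem exists_enorm_le_riesz_two (hn : 2 ≤ n) : ∃ c : ℝ≥0∞, c ≠ ⊤ ∧ ∀ φ : HalfAmbient n → ℝ,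
    ContDiff ℝ ∞ φ → HasCompactSupport φ → Continuous (Δ φ) →
    (∀ X, height X = 0 → fderiv ℝ φ X (eLast n) = 0) →
    ∀ X ∈ halfSpace n, ‖φ X‖ₑ ≤
      c * ∫⁻ Y in halfSpace n, ENNReal.ofReal (‖X - Y‖ ^ (2 - (n + 1 : ℝ))) * ‖(Δ φ) Y‖ₑ := by
  have hn' : (2 : ℝ) ≤ n := by exact_mod_cast hn
  set k : HalfAmbient n → ℝ := fun Z => (n - 1) * (n + 1) * (1 + ‖Z‖ ^ 2) ^ (-(n + 3 : ℝ) / 2)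
    with hk
  -- This uses `n ≥ 2`: for `n = 1` the factor `n - 1` vanishes, as the fundamental solution in the
  -- plane is logarithmic.
  have hkpos : ∀ Z, 0 < k Z := fun Z => by
    have : (0 : ℝ) < n - 1 := by linarith
    simp only [hk]; positivity
  have hkint : Integrable k := (integrable_rpow_neg_one_add_norm_sq
    (by rw [finrank_halfAmbient]; linarith)).const_mul _
  set c₀ := ∫ Z, k Z with hc₀
  have hc₀pos : 0 < c₀ := by
    rw [hc₀, integral_pos_iff_support_of_nonneg (fun Z => (hkpos Z).le) hkint]
    have : Function.support k = Set.univ := by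
      ext Z; simp [(hkpos Z).ne']
    rw [this]
    exact isOpen_univ.measure_pos _ Set.univ_nonempty
  have hc₀' : ENNReal.ofReal c₀ ≠ 0 := by simpa using hc₀pos
  refine ⟨2 / ENNReal.ofReal c₀, ENNReal.div_ne_top (by simp) hc₀', fun φ hφ hc hL hb X hX => ?_⟩
  have hX0 : 0 < height X := hX
  set R := ∫⁻ Y in halfSpace n, ENNReal.ofReal (‖X - Y‖ ^ (2 - (n + 1 : ℝ))) * ‖(Δ φ) Y‖ₑ with hR
  -- Uniform in `ε`: folding costs the factor `2`, and dropping `ε²` increases the kernel since its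
  -- exponent is not positive.
  have bound : ∀ ε : ℝ, 0 < ε → ‖∫ Z, φ (fold (X + ε • Z)) * k Z‖ₑ ≤ 2 * R := by
    intro ε hε
    have hε2 : 0 < ε ^ 2 := by positivity
    rw [← integral_comp_fold_mul_regularized_eq φ X hε,
      integral_comp_fold_mul_regularized hφ hc hb X hε2, enorm_neg]
    refine (enorm_integral_le_lintegral_enorm _).trans ?_
    set H : HalfAmbient n → ℝ≥0∞ := fun Y =>
      ENNReal.ofReal ((‖Y - X‖ ^ 2 + ε ^ 2) ^ (-((n - 1 : ℝ) / 2))) * ‖(Δ φ) Y‖ₑ with hH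
    have hexp : -((n - 1 : ℝ) / 2) ≤ 0 := by linarith
    calc ∫⁻ Y, ‖(Δ φ) (fold Y) * (‖Y - X‖ ^ 2 + ε ^ 2) ^ (-((n - 1 : ℝ) / 2))‖ₑ
        ≤ ∫⁻ Y, H (fold Y) := by
          refine lintegral_mono fun Y => ?_
          rw [enorm_mul, mul_comm, Real.enorm_of_nonneg (by positivity)]
          simp only [hH]
          gcongr ENNReal.ofReal ?_ * _
          refine Real.rpow_le_rpow_of_nonpos (by positivity) ?_ hexp
          have := norm_fold_sub_le hX0.le Y
          gcongr
      _ ≤ 2 * ∫⁻ Y in halfSpace n, H Y := lintegral_comp_fold_le H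
      _ ≤ 2 * R := by
          gcongr
          refine lintegral_mono_ae ?_
          have : ∀ᵐ Y ∂(volume.restrict (halfSpace n)), Y ≠ X :=
            ae_restrict_of_ae (measure_eq_zero_iff_ae_notMem.1 (measure_singleton X))
          filter_upwards [this] with Y hY
          have hYX : 0 < ‖Y - X‖ := norm_pos_iff.2 (sub_ne_zero.2 hY)
          simp only [hH]
          gcongr ENNReal.ofReal ?_ * _
          rw [norm_sub_rev X Y, show (2 - (n + 1 : ℝ)) = 2 * (-((n - 1 : ℝ) / 2)) by ring,
            Real.rpow_mul (norm_nonneg _), Real.rpow_two]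
          exact Real.rpow_le_rpow_of_nonpos (by positivity) (by linarith) hexp
  obtain ⟨M, hM⟩ := hφ.continuous.bounded_above_of_compact_support hc
  -- As `ε → 0` the left side of `bound` tends to `‖φ X‖` times the mass `c₀`.
  have hlim : Tendsto (fun ε : ℝ => ∫ Z, φ (fold (X + ε • Z)) * k Z) (𝓝[>] 0)
      (𝓝 (∫ Z, φ X * k Z)) := by
    refine tendsto_integral_filter_of_dominated_convergence (fun Z => M * k Z) ?_ ?_
      (hkint.const_mul M) ?_
    · refine Eventually.of_forall fun ε => ?_
      have := hφ.continuous
      exact (Continuous.aestronglyMeasurable (by fun_prop)).mul hkint.aestronglyMeasurable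
    · refine Eventually.of_forall fun ε => Eventually.of_forall fun Z => ?_
      rw [norm_mul, Real.norm_of_nonneg (hkpos Z).le]
      exact mul_le_mul_of_nonneg_right (hM _) (hkpos Z).le
    · refine Eventually.of_forall fun Z => ?_
      have hcont : Continuous fun ε : ℝ => φ (fold (X + ε • Z)) * k Z := by
        have := hφ.continuous
        fun_prop
      have := hcont.tendsto 0
      simp only [zero_smul, add_zero, fold_of_nonneg hX0.le] at this
      exact this.mono_left nhdsWithin_le_nhds
  have hfin : ‖∫ Z, φ X * k Z‖ₑ ≤ 2 * R := by
    refine le_of_tendsto hlim.enorm ?_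
    filter_upwards [self_mem_nhdsWithin] with ε hε using bound ε hε
  rw [integral_const_mul, enorm_mul, ← hc₀, Real.enorm_of_nonneg hc₀pos.le] at hfin
  rw [← ENNReal.mul_div_right_comm,
    ENNReal.le_div_iff_mul_le (Or.inl hc₀') (Or.inl ENNReal.ofReal_ne_top)]
  exact hfin

end SecondOrder

/-! ### Regularity and boundary values of iterated Laplacians. -/

section IteratedLaplacian

variable {n : ℕ}

theorem lapPow_succ (k : ℕ) (f : HalfAmbient n → ℝ) : lapPow (k + 1) f = Δ (lapPow k f) :=
  Function.iterate_succ_apply' _ _ _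

theorem contDiff_laplacian {f : HalfAmbient n → ℝ} (hf : ContDiff ℝ ∞ f) : ContDiff ℝ ∞ (Δ f) := by
  rw [show (Δ f) = _ from funext (laplacian_eq_sum_coord hf)]
  refine ContDiff.sum fun i _ => ?_
  have h1 : ContDiff ℝ ∞ fun Z => fderiv ℝ f Z (coordVec i) :=
    (hf.fderiv_right (m := ∞) (by simp)).clm_apply contDiff_const
  exact (h1.fderiv_right (m := ∞) (by simp)).clm_apply contDiff_const

theorem contDiff_lapPow (k : ℕ) {f : HalfAmbient n → ℝ} (hf : ContDiff ℝ ∞ f) :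
    ContDiff ℝ ∞ (lapPow k f) := by
  induction k with
  | zero => exact hf
  | succ k ih => rw [lapPow_succ]; exact contDiff_laplacian ih

theorem hasCompactSupport_lapPow (k : ℕ) {f : HalfAmbient n → ℝ} (hf : HasCompactSupport f) :
    HasCompactSupport (lapPow k f) :=
  HasCompactSupport.intro hf.isCompact fun _ hX =>
    (lapPow_eventuallyEq_zero k (notMem_tsupport_iff_eventuallyEq.mp hX)).eq_of_nhds

theorem IsTest.mono {r s : ℕ} (hrs : r ≤ s) {φ : HalfAmbient n → ℝ} (h : IsTest s φ) : IsTest r φ :=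
  ⟨h.smooth, h.compact, fun j hj => h.neumann j (hj.trans_le hrs)⟩

/-- The smooth extension makes the normal derivative continuous up to the boundary, so its one-sided
limit is its value there. -/
theorem IsTest.fderiv_lapPow_eq_zero {r j : ℕ} {φ : HalfAmbient n → ℝ} (h : IsTest r φ) (hj : j < r)
    {X : HalfAmbient n} (hX : height X = 0) : fderiv ℝ (lapPow j φ) X (eLast n) = 0 := by
  have hc : Continuous fun t : ℝ => fderiv ℝ (lapPow j φ) (X + t • eLast n) (eLast n) := by
    have := (contDiff_lapPow j h.smooth).continuous_fderiv (by simp)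
    fun_prop
  have h1 := hc.tendsto 0
  simp only [zero_smul, add_zero] at h1
  exact tendsto_nhds_unique (h1.mono_left nhdsWithin_le_nhds) (h.neumann j hj X hX)

end IteratedLaplacian

/-! ### Chaining the first and second order estimates. -/

section Chain

variable {n : ℕ}

/-- Exponents for which the weighted inequality of order `m` holds: `x`, `y` are the reciprocals of
the Lebesgue exponents and `t ^ a`, `t ^ b` the weights inside the norms. -/
structure RieszCond (n : ℕ) (m x y a b : ℝ) : Prop where
  y_pos : 0 < y
  lt : y < x
  x_lt_one : x < 1
  le : b ≤ a
  neg_lt : -y < b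
  lt_sub : a < 1 - x
  scaling : (n + 1) * x + a - m = (n + 1) * y + b

/-- The exponents of the intermediate orders, obtained by linear interpolation. -/
theorem RieszCond.interpolate {m x y a b s r : ℝ} (h : RieszCond n m x y a b) (hm : 0 < m)
    (hs : 0 ≤ s) (hr : 0 < r) (hsr : s + r ≤ m) :
    RieszCond n r (x + s / m * (y - x)) (x + (s + r) / m * (y - x))
      (a + s / m * (b - a)) (a + (s + r) / m * (b - a)) := by
  obtain ⟨h1, h2, h3, h4, h5, h6, h7⟩ := h
  have t0 : 0 ≤ s / m := by positivity
  have t1 : (s + r) / m ≤ 1 := (div_le_one hm).2 hsr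
  have t2 : s / m < (s + r) / m := by gcongr; linarith
  have t3 : ((s + r) / m - s / m) * m = r := by field_simp; ring
  set σ := s / m
  set τ := (s + r) / m
  -- All conditions are affine in the parameter. The two on sums follow from `0 < y + b < x + a <
  -- 1`, which puts every interpolated sum strictly between `0` and `1`.
  refine ⟨by nlinarith, by nlinarith, by nlinarith, by nlinarith, by nlinarith, by nlinarith, ?_⟩
  linear_combination (τ - σ) * h7 + t3

theorem RieszCond.exists_wInt_le {m x y a b : ℝ} (h : RieszCond n m x y a b) (hm : m < n + 1)
    {c : ℝ≥0∞} (hc : c ≠ ⊤) :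
    ∃ C : ℝ≥0∞, C ≠ ⊤ ∧ ∀ {V : Type} [NormedAddCommGroup V] (u : HalfAmbient n → ℝ)
      (v : HalfAmbient n → V), Measurable (fun Y => ‖v Y‖ₑ) →
      (∀ X ∈ halfSpace n, ‖u X‖ₑ ≤
        c * ∫⁻ Y in halfSpace n, ENNReal.ofReal (‖X - Y‖ ^ (m - (n + 1))) * ‖v Y‖ₑ) →
      wInt (b / y) (1 / y) u ^ y ≤ C * wInt (a / x) (1 / x) v ^ x :=
  exists_wInt_le_of_riesz_bound h.y_pos h.lt h.x_lt_one h.le h.neg_lt h.lt_sub hm h.scaling hc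

/-- Each Laplacian moves the exponents two units of order from `(y, b)` towards `(x, a)`; at `Δ^j φ`
there remain `m - 2j` units, whence the parameter `(m - 2j)/m`. The requirement `2 ≤ n` is
conditional so that `j = 0` stays available for `n = 1`. -/
theorem exists_wInt_le_lapPow {m x y a b : ℝ} (h : RieszCond n m x y a b) (hm : 0 < m) (j : ℕ)
    (hj : 2 * (j : ℝ) ≤ m) (hn : j ≠ 0 → 2 ≤ n) :
    ∃ C : ℝ≥0∞, C ≠ ⊤ ∧ ∀ φ : HalfAmbient n → ℝ, IsTest j φ →
      wInt (b / y) (1 / y) φ ^ y ≤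
        C * wInt ((a + (m - 2 * j) / m * (b - a)) / (x + (m - 2 * j) / m * (y - x)))
          (1 / (x + (m - 2 * j) / m * (y - x))) (lapPow j φ) ^ (x + (m - 2 * j) / m * (y - x)) := by
  induction j with
  | zero =>
    refine ⟨1, by simp, fun φ _ => le_of_eq ?_⟩
    simp [hm.ne', lapPow]
  | succ j ih =>
    have hn2 : 2 ≤ n := hn (by simp)
    have hn' : (2 : ℝ) ≤ n := by exact_mod_cast hn2
    push_cast at hj
    obtain ⟨C, hC, H⟩ := ih (by linarith) fun _ => hn2
    obtain ⟨c, hc, Hc⟩ := exists_enorm_le_riesz_two hn2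
    -- A second order step from `Δ^(j+1) φ`, at position `m - 2(j+1)`, to `Δ^j φ`, at position `m -
    -- 2j`.
    obtain ⟨C', hC', H'⟩ := (h.interpolate hm (s := m - 2 * (j + 1)) (r := 2) (by linarith)
      two_pos (by linarith)).exists_wInt_le (by linarith) hc
    refine ⟨C * C', ENNReal.mul_ne_top hC hC', fun φ hφ => (H φ (hφ.mono (by simp))).trans ?_⟩
    have sm := contDiff_lapPow j hφ.smooth
    have h1 := H' (lapPow j φ) (lapPow (j + 1) φ)
      (contDiff_lapPow (j + 1) hφ.smooth).continuous.enorm.measurable (fun X hX => by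
        rw [lapPow_succ]
        exact Hc (lapPow j φ) sm (hasCompactSupport_lapPow j hφ.compact)
          (contDiff_laplacian sm).continuous
          (fun Z hZ => hφ.fderiv_lapPow_eq_zero (by simp) hZ) X hX)
    rw [mul_assoc]
    refine mul_le_mul_right ?_ C
    rw [show m - 2 * (j + 1 : ℝ) + 2 = m - 2 * j by ring] at h1
    push_cast
    exact h1

theorem exists_test_le_even {x y a b : ℝ} {k : ℕ} (hk : k ≠ 0)
    (h : RieszCond n (2 * k : ℕ) x y a b) (hn : 2 ≤ n) :
    ∃ C : ℝ≥0∞, C ≠ ⊤ ∧ ∀ φ : HalfAmbient n → ℝ, IsTest k φ →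
      wInt (b / y) (1 / y) φ ^ y ≤ C * wInt (a / x) (1 / x) (lapPow k φ) ^ x := by
  have := exists_wInt_le_lapPow h (by positivity) k (by simp) fun _ => hn
  simpa using this

theorem exists_test_le_odd {x y a b : ℝ} {k : ℕ} (h : RieszCond n (2 * k + 1 : ℕ) x y a b)
    (hn1 : 1 ≤ n) (hn : k ≠ 0 → 2 ≤ n) :
    ∃ C : ℝ≥0∞, C ≠ ⊤ ∧ ∀ φ : HalfAmbient n → ℝ, IsTest k φ →
      wInt (b / y) (1 / y) φ ^ y ≤ C * wInt (a / x) (1 / x) (fun X => ∇ (lapPow k φ) X) ^ x := by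
  have hn1' : (1 : ℝ) ≤ n := by exact_mod_cast hn1
  obtain ⟨C, hC, H⟩ := exists_wInt_le_lapPow h (by positivity) k (by simp) hn
  obtain ⟨c, hc, Hc⟩ := exists_enorm_le_riesz_one n
  -- The one gradient step takes positions `0` to `1`, and `1 = m - 2k` is where the chain of
  -- Laplacians takes over.
  obtain ⟨C', hC', H'⟩ := (h.interpolate (by positivity) (s := 0) (r := 1) le_rfl
    one_pos (by simp)).exists_wInt_le (by linarith) hc
  refine ⟨C * C', ENNReal.mul_ne_top hC hC', fun φ hφ => (H φ hφ).trans ?_⟩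
  have sm := contDiff_lapPow k hφ.smooth
  have h1 := H' (lapPow k φ) (fun X => ∇ (lapPow k φ) X) (by
      simp_rw [enorm_gradient]
      exact (sm.continuous_fderiv (by simp)).enorm.measurable)
    (fun X hX => Hc (lapPow k φ) (sm.of_le (by simp)) (hasCompactSupport_lapPow k hφ.compact) X hX)
  rw [mul_assoc]
  refine mul_le_mul_right ?_ C
  simpa using h1

theorem ExpCond.critExp_pos {m : ℕ} {p a b : ℝ} (h : ExpCond n m p a b) : 0 < critExp n m p a b := by
  linarith [h.one_lt, h.lt_critExp]

/-- The dictionary to reciprocal exponents: the scaling identity is the formula for the critical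
exponent, `b ≤ a` is the upper bound on `β`, `-y < b` is `β > -1`, and `a < 1 - x` is `α < p - 1`.
-/
theorem ExpCond.rieszCond {m : ℕ} {p a b : ℝ} (h : ExpCond n m p a b) (hmp : m * p < n + 1) :
    RieszCond n m (1 / p) (1 / critExp n m p a b) (a / p) (b / critExp n m p a b) := by
  have hq := h.critExp_pos
  obtain ⟨h1, h2, h3, h4, h5, h6⟩ := h
  set q := critExp n m p a b with hqdef
  have hp : 0 < p := by linarith
  have hN : (0 : ℝ) < n + 1 + b := by
    have : (0 : ℝ) ≤ n := by positivity
    linarith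
  have hD : 0 < n + 1 + a - m * p := by
    by_contra hcon
    have : q ≤ 0 := div_nonpos_of_nonneg_of_nonpos (by positivity) (not_lt.1 hcon)
    linarith
  have hqD : q * (n + 1 + a - m * p) = p * (n + 1 + b) := by
    rw [hqdef, critExp, div_mul_cancel₀ _ hD.ne']
  have hle : b * (n + 1 - m * p) ≤ a * (n + 1) := (le_div_iff₀ (by linarith)).1 h6
  refine ⟨by positivity, one_div_lt_one_div_of_lt hp h2, (div_lt_one hp).2 h1, ?_, ?_, ?_, ?_⟩
  · rw [div_le_div_iff₀ hq hp]
    refine le_of_mul_le_mul_right ?_ hD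
    have : a * q * (n + 1 + a - m * p) = a * (p * (n + 1 + b)) := by rw [← hqD]; ring
    rw [this]
    nlinarith
  · rw [← neg_div]; gcongr
  · rw [lt_sub_iff_add_lt, ← add_div, div_lt_one hp]; linarith
  · field_simp
    linear_combination hqD

end Chain

/-! ### From test functions to the completion. -/

section Density

variable {n : ℕ}

theorem wInt_congr {V : Type*} [NormedAddCommGroup V] {a q : ℝ} {F G : HalfAmbient n → V}
    (h : ∀ᵐ X, X ∈ halfSpace n → F X = G X) : wInt a q F = wInt a q G := by
  refine lintegral_congr_ae ?_
  filter_upwards [(ae_restrict_iff' measurableSet_halfSpace).2 h] with X hX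
  rw [hX]

/-- Two locally integrable functions with the same integrals against test functions agree. -/
theorem ae_eq_of_integral_smul_eq {V : Type*} [NormedAddCommGroup V] [NormedSpace ℝ V]
    [CompleteSpace V] {F G : HalfAmbient n → V} (hF : LocallyIntegrableOn F (halfSpace n))
    (hG : LocallyIntegrableOn G (halfSpace n))
    (h : ∀ ψ : HalfAmbient n → ℝ, ContDiff ℝ ∞ ψ → HasCompactSupport ψ → tsupport ψ ⊆ halfSpace n →
      ∫ X in halfSpace n, ψ X • F X = ∫ X in halfSpace n, ψ X • G X) :
    ∀ᵐ X, X ∈ halfSpace n → F X = G X := by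
  have key := isOpen_halfSpace.ae_eq_zero_of_integral_contDiff_smul_eq_zero (hF.sub hG)
    (fun ψ h1 h2 h3 => ?_)
  · filter_upwards [key] with X hX hmem
    exact sub_eq_zero.1 (hX hmem)
  · have hint : ∀ {F : HalfAmbient n → V}, LocallyIntegrableOn F (halfSpace n) →
        Integrable (fun X => ψ X • F X) := by
      intro F hF
      have := (hF.integrableOn_compact_subset h3 h2.isCompact).continuousOn_smul
        h1.continuous.continuousOn h2.isCompact
      rwa [integrableOn_iff_integrable_of_support_subset] at this
      intro X hX
      by_contra hcon
      exact hX (by simp [image_eq_zero_of_notMem_tsupport hcon])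
    have hz : ∀ (F : HalfAmbient n → V),
        ∫ X in halfSpace n, ψ X • F X = ∫ X, ψ X • F X := fun F =>
      setIntegral_eq_integral_of_forall_compl_eq_zero fun X hX => by
        simp [image_eq_zero_of_notMem_tsupport fun hc => hX (h3 hc)]
    have h4 := h ψ h1 h2 h3
    rw [hz, hz] at h4
    simp_rw [Pi.sub_apply, smul_sub]
    rw [integral_sub (hint hF) (hint hG), h4, sub_self]

/-- A compact exhaustion of the half space. -/
def halfExhaustion (n : ℕ) (j : ℕ) : Set (HalfAmbient n) :=
  {X | ‖X‖ ≤ j ∧ 1 / ((j : ℝ) + 1) ≤ height X}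

theorem isCompact_halfExhaustion (j : ℕ) : IsCompact (halfExhaustion n j) := by
  refine (isCompact_closedBall (0 : HalfAmbient n) j).of_isClosed_subset ?_ fun X hX => ?_
  · exact (isClosed_le continuous_norm continuous_const).inter
      (isClosed_le continuous_const continuous_height)
  · simpa using hX.1

theorem halfExhaustion_subset (j : ℕ) : halfExhaustion n j ⊆ halfSpace n := fun _ hX =>
  lt_of_lt_of_le (by positivity) hX.2

theorem monotone_halfExhaustion : Monotone (halfExhaustion n) := by
  intro i j hij X hX
  have : (i : ℝ) ≤ j := by exact_mod_cast hij
  exact ⟨hX.1.trans this, le_trans (by gcongr) hX.2⟩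

theorem iUnion_halfExhaustion : ⋃ j, halfExhaustion n j = halfSpace n := by
  refine Set.Subset.antisymm (Set.iUnion_subset halfExhaustion_subset) fun X hX => ?_
  obtain ⟨i, hi⟩ := exists_nat_ge ‖X‖
  obtain ⟨k, hk⟩ := exists_nat_one_div_lt (show 0 < height X from hX)
  refine Set.mem_iUnion.2 ⟨max i k, ?_, ?_⟩
  · exact hi.trans (by exact_mod_cast le_max_left i k)
  · refine le_trans ?_ hk.le
    gcongr
    exact le_max_right i k

/-- Lower semicontinuity of weighted integrals under local convergence in mean. -/
theorem wInt_le_of_tendstoL1Loc {b q : ℝ} {φ : ℕ → HalfAmbient n → ℝ}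
    {u : HalfAmbient n → ℝ} (hφ : ∀ i, Continuous (φ i)) (hu : LocallyIntegrableOn u (halfSpace n))
    (hlim : TendstoL1Loc φ u) {B : ℕ → ℝ≥0∞} {B₀ : ℝ≥0∞} (hB : ∀ i, wInt b q (φ i) ≤ B i)
    (hB₀ : Tendsto B atTop (𝓝 B₀)) : wInt b q u ≤ B₀ := by
  have hK : ∀ j, ∫⁻ X in halfExhaustion n j, ENNReal.ofReal (height X ^ b) * ‖u X‖ₑ ^ q ≤ B₀ := by
    intro j
    set K := halfExhaustion n j
    have hL1 := hlim K (isCompact_halfExhaustion j) (halfExhaustion_subset j)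
    have hm : TendstoInMeasure (volume.restrict K) φ atTop u := by
      refine tendstoInMeasure_of_tendsto_eLpNorm one_ne_zero
        (fun i => (hφ i).aestronglyMeasurable)
        (hu.integrableOn_compact_subset (halfExhaustion_subset j)
          (isCompact_halfExhaustion j)).aestronglyMeasurable ?_
      simpa only [eLpNorm_one_eq_lintegral_enorm, Pi.sub_apply] using hL1
    -- On a compact set, convergence in mean yields an almost everywhere convergent subsequence, to
    -- which Fatou's lemma applies.
    obtain ⟨ns, hns, hae⟩ := hm.exists_seq_tendsto_ae
    calc ∫⁻ X in K, ENNReal.ofReal (height X ^ b) * ‖u X‖ₑ ^ q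
        = ∫⁻ X in K, liminf (fun i => ENNReal.ofReal (height X ^ b) * ‖φ (ns i) X‖ₑ ^ q) atTop := by
          refine lintegral_congr_ae ?_
          filter_upwards [hae] with X hX
          refine (Tendsto.liminf_eq ?_).symm
          refine ENNReal.Tendsto.const_mul ?_ (Or.inr ENNReal.ofReal_ne_top)
          exact (ENNReal.continuous_rpow_const.tendsto _).comp hX.enorm
      _ ≤ liminf (fun i => ∫⁻ X in K, ENNReal.ofReal (height X ^ b) * ‖φ (ns i) X‖ₑ ^ q) atTop := by
          refine lintegral_liminf_le fun i => ?_
          have := (hφ (ns i)).measurable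
          fun_prop
      _ ≤ liminf (fun i => B (ns i)) atTop := by
          refine liminf_le_liminf (Eventually.of_forall fun i => ?_)
          exact (lintegral_mono_set (halfExhaustion_subset j)).trans (hB (ns i))
      _ = B₀ := (hB₀.comp hns.tendsto_atTop).liminf_eq
  rw [wInt, ← iUnion_halfExhaustion,
    setLIntegral_iUnion_of_directed _ (monotone_halfExhaustion.directed_le)]
  exact iSup_le hK

/-- Convexity of `r ↦ r ^ p`. The factor `2 ^ (p - 1)` is harmless, as the final constant is not
claimed to be sharp, and only `G` needs to be measurable. -/
theorem wInt_le_add {V : Type*} [NormedAddCommGroup V] {a p : ℝ} (hp : 1 ≤ p)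
    {F G : HalfAmbient n → V} (hG : LocallyIntegrableOn G (halfSpace n)) :
    wInt a p F ≤ 2 ^ (p - 1) * (wInt a p (fun X => F X - G X) + wInt a p G) := by
  have hm : AEMeasurable (fun X => ‖G X‖ₑ) (volume.restrict (halfSpace n)) :=
    hG.aestronglyMeasurable.enorm
  have h2 : (2 : ℝ≥0∞) ^ (p - 1) ≠ ⊤ := by simp [ENNReal.rpow_eq_top_iff]
  unfold wInt
  rw [← lintegral_add_right' _ (by fun_prop), ← lintegral_const_mul' _ _ h2]
  refine lintegral_mono fun X => ?_
  calc ENNReal.ofReal (height X ^ a) * ‖F X‖ₑ ^ p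
      ≤ ENNReal.ofReal (height X ^ a) * (2 ^ (p - 1) * (‖F X - G X‖ₑ ^ p + ‖G X‖ₑ ^ p)) := by
        gcongr
        refine le_trans ?_ (ENNReal.rpow_add_le_mul_rpow_add_rpow _ _ hp)
        refine ENNReal.rpow_le_rpow ?_ (by linarith)
        simpa using enorm_add_le (F X - G X) (G X)
    _ = _ := by ring

/-- Passage from test functions to the completion. -/
theorem exists_wInt_le_of_test {V : Type*} [NormedAddCommGroup V] {p q a b : ℝ} (hp : 1 < p)
    (hq : 0 < q) {T : (HalfAmbient n → ℝ) → Prop} {D : (HalfAmbient n → ℝ) → HalfAmbient n → V}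
    (hT : ∀ φ, T φ → Continuous φ) {C : ℝ≥0∞} (hC : C ≠ ⊤)
    (H : ∀ φ, T φ → wInt b q φ ^ (1 / q) ≤ C * wInt a p (D φ) ^ (1 / p)) :
    ∃ S : ℝ, 0 < S ∧ ∀ (u : HalfAmbient n → ℝ) (G : HalfAmbient n → V),
      LocallyIntegrableOn u (halfSpace n) → LocallyIntegrableOn G (halfSpace n) →
      (∃ φ : ℕ → HalfAmbient n → ℝ, (∀ i, T (φ i)) ∧ TendstoL1Loc φ u ∧
        Tendsto (fun i => wInt a p (fun X => D (φ i) X - G X)) atTop (𝓝 0)) →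
      wInt b q u ^ (p / q) ≤ ENNReal.ofReal S * wInt a p G := by
  have hp0 : 0 < p := by linarith
  set c : ℝ≥0∞ := C ^ p * 2 ^ (p - 1) with hc
  have hCp : C ^ p ≠ ⊤ := by simp [ENNReal.rpow_eq_top_iff, hC, hp0.le]
  have h2 : (2 : ℝ≥0∞) ^ (p - 1) ≠ ⊤ := by simp [ENNReal.rpow_eq_top_iff]
  have hct : c ≠ ⊤ := ENNReal.mul_ne_top hCp h2
  -- Adding `1` makes the constant strictly positive even if `c = 0`.
  refine ⟨c.toReal + 1, by positivity, fun u G hu hG ⟨φ, hφT, hφu, hφG⟩ => ?_⟩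
  set B : ℕ → ℝ≥0∞ := fun i =>
    (c * (wInt a p (fun X => D (φ i) X - G X) + wInt a p G)) ^ (q / p) with hBdef
  have hB : ∀ i, wInt b q (φ i) ≤ B i := by
    intro i
    have h3 := ENNReal.rpow_le_rpow (H (φ i) (hφT i)) hq.le
    rw [← ENNReal.rpow_mul, one_div, inv_mul_cancel₀ hq.ne', ENNReal.rpow_one] at h3
    refine h3.trans ?_
    have h4 : C * wInt a p (D (φ i)) ^ (1 / p) = (C ^ p * wInt a p (D (φ i))) ^ (1 / p) := by
      rw [ENNReal.mul_rpow_of_nonneg _ _ (by positivity), ← ENNReal.rpow_mul, mul_one_div_cancel hp0.ne',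
        ENNReal.rpow_one]
    rw [h4, ← ENNReal.rpow_mul, one_div, inv_mul_eq_div, hBdef]
    refine ENNReal.rpow_le_rpow ?_ (by positivity)
    rw [hc, mul_assoc]
    exact mul_le_mul_right (wInt_le_add hp.le hG) _
  have hlim : Tendsto B atTop (𝓝 ((c * (0 + wInt a p G)) ^ (q / p))) := by
    refine (ENNReal.continuous_rpow_const.tendsto _).comp ?_
    exact ENNReal.Tendsto.const_mul (hφG.add tendsto_const_nhds) (Or.inr hct)
  have h5 := wInt_le_of_tendstoL1Loc (fun i => hT _ (hφT i)) hu hφu hB hlim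
  rw [zero_add] at h5
  have h6 := ENNReal.rpow_le_rpow h5 (by positivity : 0 ≤ p / q)
  rw [← ENNReal.rpow_mul, div_mul_div_cancel₀ hp0.ne', div_self hq.ne', ENNReal.rpow_one] at h6
  refine h6.trans ?_
  gcongr
  rw [ENNReal.ofReal_add ENNReal.toReal_nonneg zero_le_one, ENNReal.ofReal_toReal hct]
  exact le_self_add

end Density

/-! ### Assembly of the odd and even cases. -/

section Main

variable {n : ℕ}

theorem weightedSobolev_odd {k : ℕ} {p a b : ℝ} (hn : 1 ≤ n) (hnk : k ≠ 0 → 2 ≤ n)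
    (h : ExpCond n (2 * k + 1) p a b) (hmp : ((2 * k + 1 : ℕ) : ℝ) * p < n + 1) :
    ∃ C : ℝ, 0 < C ∧ ∀ u : HalfAmbient n → ℝ, MemSobolevOdd k a p u →
      ∀ G : HalfAmbient n → HalfAmbient n, IsWeakGradLap k u G →
        wInt b (critExp n (2 * k + 1) p a b) u ^ (p / critExp n (2 * k + 1) p a b) ≤
          ENNReal.ofReal C * wInt a p G := by
  have hq := h.critExp_pos
  have hp : 0 < p := by linarith [h.one_lt]
  obtain ⟨C, hC, H⟩ := exists_test_le_odd (h.rieszCond hmp) hn hnk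
  rw [div_div_div_cancel_right₀ hq.ne', div_div_div_cancel_right₀ hp.ne', one_div_one_div,
    one_div_one_div, div_one, div_one] at H
  obtain ⟨S, hS, HS⟩ := exists_wInt_le_of_test h.one_lt hq
    (fun φ (hφ : IsTest k φ) => hφ.smooth.continuous) hC H
  refine ⟨S, hS, fun u hu G hG => ?_⟩
  obtain ⟨hloc, G₀, hG₀, -, hφ⟩ := hu
  -- The weak derivative `G` is arbitrary; uniqueness replaces it by the one to which the test
  -- functions converge.
  rw [wInt_congr (ae_eq_of_integral_smul_eq hG.locInt hG₀.locInt fun ψ h1 h2 h3 => by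
    rw [hG.eq ψ h1 h2 h3, hG₀.eq ψ h1 h2 h3])]
  exact HS u G₀ hloc hG₀.locInt hφ

theorem weightedSobolev_even {k : ℕ} {p a b : ℝ} (hk : k ≠ 0) (hn : 2 ≤ n)
    (h : ExpCond n (2 * k) p a b) (hmp : ((2 * k : ℕ) : ℝ) * p < n + 1) :
    ∃ C : ℝ, 0 < C ∧ ∀ u : HalfAmbient n → ℝ, MemSobolevEven k a p u →
      ∀ g : HalfAmbient n → ℝ, IsWeakLap k u g →
        wInt b (critExp n (2 * k) p a b) u ^ (p / critExp n (2 * k) p a b) ≤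
          ENNReal.ofReal C * wInt a p g := by
  have hq := h.critExp_pos
  have hp : 0 < p := by linarith [h.one_lt]
  obtain ⟨C, hC, H⟩ := exists_test_le_even hk (h.rieszCond hmp) hn
  rw [div_div_div_cancel_right₀ hq.ne', div_div_div_cancel_right₀ hp.ne', one_div_one_div,
    one_div_one_div, div_one, div_one] at H
  obtain ⟨S, hS, HS⟩ := exists_wInt_le_of_test h.one_lt hq
    (fun φ (hφ : IsTest k φ) => hφ.smooth.continuous) hC H
  refine ⟨S, hS, fun u hu g hg => ?_⟩
  obtain ⟨hloc, g₀, hg₀, -, hφ⟩ := hu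
  rw [wInt_congr (ae_eq_of_integral_smul_eq hg.locInt hg₀.locInt fun ψ h1 h2 h3 => by
    simp only [smul_eq_mul]
    rw [hg.eq ψ h1 h2 h3, hg₀.eq ψ h1 h2 h3])]
  exact HS u g₀ hloc hg₀.locInt hφ

/-- Guarantees that the order-two potential bound is available whenever a Laplacian occurs. -/
theorem two_le_of_mul_lt {m : ℕ} {p : ℝ} (hm : 2 ≤ m) (hp : 1 < p) (h : (m : ℝ) * p < n) :
    2 ≤ n := by
  have hm' : (2 : ℝ) ≤ m := by exact_mod_cast hm
  have : (2 : ℝ) < n := by nlinarith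
  exact_mod_cast this.le

end Main

theorem theorem1p10 :
    (∀ (n : ℕ) (p α₁ β₁ : ℝ), 1 ≤ n → p < (n : ℝ) + 1 → ExpCond n 1 p α₁ β₁ →
      ∃ S : ℝ, 0 < S ∧ ∀ u : HalfAmbient n → ℝ, MemSobolevOdd 0 α₁ p u →
        ∀ G : HalfAmbient n → HalfAmbient n, IsWeakGradLap 0 u G →
          wInt β₁ (critExp n 1 p α₁ β₁) u ^ (p / critExp n 1 p α₁ β₁) ≤
            ENNReal.ofReal S * wInt α₁ p G) ∧
    (∀ (n m : ℕ) (p α β : ℝ), 1 ≤ n → 1 ≤ m → (m : ℝ) * p < n → ExpCond n m p α β →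
      (Odd m → ∃ C : ℝ, 0 < C ∧ ∀ u : HalfAmbient n → ℝ, MemSobolevOdd ((m - 1) / 2) α p u →
        ∀ G : HalfAmbient n → HalfAmbient n, IsWeakGradLap ((m - 1) / 2) u G →
          wInt β (critExp n m p α β) u ^ (p / critExp n m p α β) ≤
            ENNReal.ofReal C * wInt α p G) ∧
      (Even m → ∃ C : ℝ, 0 < C ∧ ∀ u : HalfAmbient n → ℝ, MemSobolevEven (m / 2) α p u →
        ∀ g : HalfAmbient n → ℝ, IsWeakLap (m / 2) u g →
          wInt β (critExp n m p α β) u ^ (p / critExp n m p α β) ≤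
            ENNReal.ofReal C * wInt α p g)) := by
  refine ⟨fun n p a b hn hp h => ?_, fun n m p a b hn hm hmp h => ⟨?_, ?_⟩⟩
  · exact weightedSobolev_odd (k := 0) hn (by simp) h (by simpa using hp)
  · rintro ⟨k, rfl⟩
    rw [show (2 * k + 1 - 1) / 2 = k by omega]
    exact weightedSobolev_odd hn (fun hk => two_le_of_mul_lt (by omega) h.one_lt hmp) h
      (by linarith)
  · intro hev
    obtain ⟨k, rfl⟩ := hev.two_dvd
    rw [show 2 * k / 2 = k by omega]
    exact weightedSobolev_even (by omega) (two_le_of_mul_lt (by omega) h.one_lt hmp) h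
      (by linarith)
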